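/- **Setting.** Let $BS(1,2)=\langle a,t\mid t^{-1}at=a^2\rangle$ and, for $k,\ell\in\mathbb N$, let $R_{k,\ell}=\{t^{\ell}a^it^{-j}\mid 0\le i\le (k+1)2^{\ell-1}-1,\ 0\le j\le \ell\}$. For a finite alphabet $\mathcal R$ and $X\subseteq\mathcal R^{BS(1,2)}$ let $\mathcal L_{k,\ell}(X)$ be the set of patterns $p\in\mathcal R^{R_{k,\ell}}$ for which there are $x\in X$, $g\in BS(1,2)$ with $x_{gh}=p_h$ for all $h\in R_{k,\ell}$. The entropy of $X$ is $h(X)=\lim_{k,\ell\to\infty}\frac{\log \#\mathcal L_{k,\ell}(X)}{|R_{k,\ell}|}$ (convention $\log 0=0$ if $X=\emptyset$). $X$ is an SFT if it is the set of configurations avoiding some finite set of patterns. Let $\mathcal A$ be a finite alphabet with at least two letters, $\sigma:\mathcal A\to\mathcal A^*$ a primitive substitution with incidence matrix $M_\sigma(c,d)=|\sigma(c)|_d$, and $\lambda\in\mathbb R$, $v\in\mathbb R^{\mathcal A}$ with $M_\sigma v=\lambda v$, $\lambda\ge 8$ and $v(c)\ge 3$ for all $c$. Put $h=\lfloor\log_2\lambda\rfloor-1$,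 $w_c=\lfloor v(c)\rfloor-1$ and $M=\max_c|\sigma(c)|$. Labels are pairs $(c,i)\in\mathcal A\times\{1,\dots,M\}$. **Alphabet.** The letters are $t_1(l,r),t_2(r),t_3(r),t_4(r)$ (top), $m_1(r),m_2(l,r),m_3(r),m_4(r),m_5(r)$ (middle), $b_1(r),b_2(r),b_3(r)$ (bottom), with labels $l,r$. The tile in position $g$ is the pentagon whose left edge is $[g,gt]$, right edge $[ga,gat]$, top edge $[g,ga]$ and bottom edges $[gt,gta]$, $[gta,gta^2]$. Its edges are blank or shaded, with a label, on a part of the edge (vertical edges: lower half L, upper half U, all F; horizontal edges: left half L, right half R, all F), as follows (– is blank): | letter | left | right | top | bottom left | bottom right | |---|---|---|---|---|---| | $t_1(l,r)$ | L $l$ | L $r$ | – | L $l$ | R $r$ | | $t_2(r)$ | – | L $r$ | – | R $r$ | F $r$ | | $t_3(r)$ | L $r$ | L $r$ | – | F $r$ | F $r$ | | $t_4(r)$ | L $r$ | – | – | F $r$ | L $r$ | | $m_1(r)$ | – | F $r$ | R $r$ | R $r$ | F $r$ | | $m_2(l,r)$ | L $l$ | F $r$ | R $r$ | L $l$ | R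 $r$ | | $m_3(r)$ | F $r$ | F $r$ | F $r$ | F $r$ | F $r$ | | $m_4(r)$ | F $r$ | – | L $r$ | F $r$ | L $r$ | | $m_5(r)$ | F $r$ | L $r$ | L $r$ | F $r$ | F $r$ | | $b_1(r)$ | – | U $r$ | R $r$ | – | – | | $b_2(r)$ | U $r$ | U $r$ | F $r$ | – | – | | $b_3(r)$ | U $r$ | – | L $r$ | – | – | The letters $t_1,t_2,m_1,m_2,b_1$ are *left borders*, of label $r$. A left border in position $u$ has *width* $n\ge1$ if the next left border among $ua,ua^2,\dots$ is at $ua^n$. **Local rules** (for all $g$; $lo,hi:\mathcal A\to\mathbb N$ are bounds). 1. Colours agree on common edges. 2. $x_g$ and $x_{ga}$ have the same type (top, middle, bottom). 3. If $x_g$ is a top letter, then, for some $m\in\{h-1,h\}$, $x_{gt},\dots,x_{gt^m}$ are middle and $x_{gt^{m+1}}$ is bottom; and $x_g,x_{gt},\dots,x_{gt^h}$ are not all middle. If $x_g$ is a top letter and $u\in\{gt,gta\}$, then there are $0\le s<n$ such that at $ua^{-s}$ there is a left border of width $n$, and $lo(c)\le n\le hi(c)$, where $(c,i)$ is its label. 4.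 $x_g=t_1(l,r)\Rightarrow x_{gtat^{-1}}=t_2(r)$ and $x_{gta^{-1}t^{-1}}=t_4(l)$; for $\beta\in\{b_1,b_3\}$: $x_g=\beta(r)\Rightarrow x_{gtat^{-1}}=\beta(r)$ or $x_{gta^{-1}t^{-1}}=\beta(r)$; $x_g=m_1(r)\Leftrightarrow x_{gta^{-1}t^{-1}}=m_2(l,r)$ for some $l$. 5. If $x_g=b_1(c,i)$, then one of $gt,gta$ carries a left border with index $1$; put $e(g)=0$ if $gt$ does and $e(g)=1$ otherwise. Moreover $g$ has a width $n\le 2^h\,hi(c)$, and the labels of the left borders in the positions $gta^q$, $e(g)\le q<2n+e(ga^n)$, read from left to right, are $(c_1,1),\dots,(c_k,k)$, where $\sigma(c)=c_1\cdots c_k$. Let $X_\sigma^{lo,hi}$ be the set of configurations satisfying these rules, and let $X_\sigma$ be $X_\sigma^{lo,hi}$ for $lo(c)=w_c-1$, $hi(c)=2w_c-1$. **Proposition.** The set $X_\sigma$ is an SFT, its entropy (the limit above) exists and $h(X_\sigma)=0$. Moreover there is $c\in\mathbb N$ such that, for all $k,\ell$, every pattern of $\mathcal L_{k,\ell}(X_\sigma)$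 is determined, among the patterns in $\mathcal L_{k,\ell}(X_\sigma)$, by its restriction to the boundary region $$\partial_cR_{k,\ell}=\{t^\ell a^it^{-j}\in R_{k,\ell}\mid j\le c\text{ or }j\ge\ell-c\text{ or }i<2^{\ell-1}\text{ or }i\ge k2^{\ell-1}\}$$ (with $i,j$ in the ranges defining $R_{k,\ell}$), and $|\partial_cR_{k,\ell}|/|R_{k,\ell}|\to0$ as $k,\ell\to\infty$, for every $c$. The same holds for $X_\sigma^{lo,hi}$ for all bounds $lo,hi:\mathcal A\to\mathbb N$. -/

import Mathlib

namespace BSTiling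

/-! ### The group `BS(1,2)` -/

inductive Gen
  | a
  | t

/-- The single relator of `BS(1,2) = ⟨a, t ∣ t⁻¹ a t = a²⟩`. -/
def rels : Set (FreeGroup Gen) :=
  {(FreeGroup.of Gen.t)⁻¹ * FreeGroup.of Gen.a * FreeGroup.of Gen.t *
    (FreeGroup.of Gen.a ^ 2)⁻¹}

/-- The Baumslag-Solitar group `BS(1,2)`. -/
abbrev BS12 : Type := PresentedGroup rels

/-- The generator `a` (one step to the right). -/
def a : BS12 := PresentedGroup.of Gen.a

/-- The generator `t` (one step down). -/
def t : BS12 := PresentedGroup.of Gen.t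

open Classical in
/-- The rectangle `R_{k,ℓ}`: all `t^ℓ a^i t^{-j}` with `0 ≤ i ≤ (k+1) 2^(ℓ-1) - 1`, `0 ≤ j ≤ ℓ`. -/
noncomputable def rect (k l : ℕ) : Finset BS12 :=
  (Finset.range ((k + 1) * 2 ^ l / 2) ×ˢ Finset.range (l + 1)).image
    fun q => t ^ l * a ^ q.1 * (t ^ q.2)⁻¹

open Classical in
/-- The boundary region of thickness `c` of `R_{k,ℓ}`: its levels `j ≤ c` and `j ≥ ℓ - c`
(bottom and top), together with its parts `i < 2^(ℓ-1)` and `i ≥ k 2^(ℓ-1)` (left and right). -/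
noncomputable def rectBoundary (c k l : ℕ) : Finset BS12 :=
  ((Finset.range ((k + 1) * 2 ^ l / 2) ×ˢ Finset.range (l + 1)).filter
    fun q => q.2 ≤ c ∨ l ≤ q.2 + c ∨ 2 * q.1 < 2 ^ l ∨ k * 2 ^ l ≤ 2 * q.1).image
    fun q => t ^ l * a ^ q.1 * (t ^ q.2)⁻¹

/-! ### Subshifts of finite type, language and entropy -/

/-- The shift action `(𝔖_g x)_h = x_{g⁻¹ h}`. -/
def shift {G B : Type*} [Group G] (g : G) (x : G → B) : G → B := fun h => x (g⁻¹ * h)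

/-- The pattern `p`, with finite support `S`, appears in the configuration `x`. -/
def Appears {G B : Type*} [Group G] {S : Finset G} (p : S → B) (x : G → B) : Prop :=
  ∃ g : G, ∀ h : S, p h = shift g x h

/-- `X` is a subshift of finite type: it is the set of all configurations that avoid some
finite set `F` of patterns. -/
def IsSFT {G B : Type*} [Group G] (X : Set (G → B)) : Prop :=
  ∃ F : Set (Σ S : Finset G, (S → B)), F.Finite ∧
    X = {x | ∀ p ∈ F, ¬ Appears p.2 x}

/-- The language of size `(k,ℓ)`: the patterns with support `R_{k,ℓ}` that appear in some
configuration of `X` (globally admissible patterns). -/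
def language {B : Type*} (X : Set (BS12 → B)) (k l : ℕ) : Set (rect k l → B) :=
  {p | ∃ x ∈ X, ∃ g : BS12, ∀ h : rect k l, x (g * h) = p h}

/-- The entropy of `X`, the limit of `log #L_{k,ℓ}(X) / |R_{k,ℓ}|` as `k, ℓ → ∞`, exists and
equals `c`. -/
def HasEntropy {B : Type*} (X : Set (BS12 → B)) (c : ℝ) : Prop :=
  Filter.Tendsto
    (fun q : ℕ × ℕ => Real.log ((language X q.1 q.2).ncard : ℝ) / ((rect q.1 q.2).card : ℝ))
    (Filter.atTop ×ˢ Filter.atTop) (nhds c)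

/-- Every globally admissible pattern on `R_{k,ℓ}` is determined by its restriction to the
boundary region of thickness `c`. -/
def DeterminedByBoundary {B : Type*} (X : Set (BS12 → B)) (c k l : ℕ) : Prop :=
  ∀ p ∈ language X k l, ∀ q ∈ language X k l,
    (∀ g : rect k l, (g : BS12) ∈ rectBoundary c k l → p g = q g) → p = q

/-! ### Substitutions -/

section Substitution

variable {A : Type*} [DecidableEq A]

/-- The incidence matrix: its entry `(a,b)` is the number of occurrences of `b` in `σ(a)`. -/
def incidence (σ : A → List A) : Matrix A A ℕ := Matrix.of fun c d => (σ c).count d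

/-- Some power of the incidence matrix has only positive entries. -/
def IsPrimitive [Fintype A] (σ : A → List A) : Prop :=
  ∃ n : ℕ, ∀ c d : A, 0 < (incidence σ ^ n) c d

end Substitution

/-- The maximal length of a word `σ(a)`. -/
def maxLen {A : Type*} [Fintype A] (σ : A → List A) : ℕ :=
  Finset.univ.sup fun c => (σ c).length

/-- The labels `(a,i)` carried by shaded areas. Indices start at `0` here, so that the label
`(a, i)` is the one usually written `(a, i + 1)`. -/
abbrev Label {A : Type*} [Fintype A] (σ : A → List A) : Type _ := A × Fin (maxLen σ)

/-! ### The pentagonal Wang tiles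

The tile in position `g` is the pentagon with vertices `g, g a, g t, g t a, g a t = g t a²`.
Its top edge goes from `g` to `g a`, its left edge from `g` to `g t`, its right edge from `g a`
to `g a t`, and its two bottom edges from `g t` to `g t a` and from `g t a` to `g t a²`: they
are the top edges of the tiles in positions `g t` and `g t a`. -/

/-- The letters. In `t1 l r` and `m2 l r`, `l` is the label of the leftmost shaded area and `r`
the label of the rightmost one. -/
inductive Tile (L : Type*)
  | t1 (l r : L)
  | t2 (r : L)
  | t3 (r : L)
  | t4 (r : L)
  | m1 (r : L)
  | m2 (l r : L)
  | m3 (r : L)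
  | m4 (r : L)
  | m5 (r : L)
  | b1 (r : L)
  | b2 (r : L)
  | b3 (r : L)

/-- The type of a letter: top, middle or bottom. -/
inductive Kind
  | top
  | mid
  | bot

/-- Colours of vertical edges: which part of the edge is shaded, and with which label. -/
inductive VColor (L : Type*)
  | blank
  | lower (l : L)
  | upper (l : L)
  | full (l : L)

/-- Colours of horizontal edges: which part of the edge is shaded, and with which label. -/
inductive HColor (L : Type*)
  | blank
  | left (l : L)
  | right (l : L)
  | full (l : L)

namespace Tile

variable {L : Type*}

def kind : Tile L → Kind
  | t1 _ _ | t2 _ | t3 _ | t4 _ => Kind.top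
  | m1 _ | m2 _ _ | m3 _ | m4 _ | m5 _ => Kind.mid
  | b1 _ | b2 _ | b3 _ => Kind.bot

def leftEdge : Tile L → VColor L
  | t1 l _ => VColor.lower l
  | t2 _ => VColor.blank
  | t3 r => VColor.lower r
  | t4 r => VColor.lower r
  | m1 _ => VColor.blank
  | m2 l _ => VColor.lower l
  | m3 r => VColor.full r
  | m4 r => VColor.full r
  | m5 r => VColor.full r
  | b1 _ => VColor.blank
  | b2 r => VColor.upper r
  | b3 r => VColor.upper r

def rightEdge : Tile L → VColor L
  | t1 _ r => VColor.lower r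
  | t2 r => VColor.lower r
  | t3 r => VColor.lower r
  | t4 _ => VColor.blank
  | m1 r => VColor.full r
  | m2 _ r => VColor.full r
  | m3 r => VColor.full r
  | m4 _ => VColor.blank
  | m5 r => VColor.lower r
  | b1 r => VColor.upper r
  | b2 r => VColor.upper r
  | b3 _ => VColor.blank

def topEdge : Tile L → HColor L
  | t1 _ _ => HColor.blank
  | t2 _ => HColor.blank
  | t3 _ => HColor.blank
  | t4 _ => HColor.blank
  | m1 r => HColor.right r
  | m2 _ r => HColor.right r
  | m3 r => HColor.full r
  | m4 r => HColor.left r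
  | m5 r => HColor.left r
  | b1 r => HColor.right r
  | b2 r => HColor.full r
  | b3 r => HColor.left r

/-- The left one of the two bottom edges. -/
def botLeftEdge : Tile L → HColor L
  | t1 l _ => HColor.left l
  | t2 r => HColor.right r
  | t3 r => HColor.full r
  | t4 r => HColor.full r
  | m1 r => HColor.right r
  | m2 l _ => HColor.left l
  | m3 r => HColor.full r
  | m4 r => HColor.full r
  | m5 r => HColor.full r
  | b1 _ => HColor.blank
  | b2 _ => HColor.blank
  | b3 _ => HColor.blank

/-- The right one of the two bottom edges. -/
def botRightEdge : Tile L → HColor L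
  | t1 _ r => HColor.right r
  | t2 r => HColor.full r
  | t3 r => HColor.full r
  | t4 r => HColor.left r
  | m1 r => HColor.full r
  | m2 _ r => HColor.right r
  | m3 r => HColor.full r
  | m4 r => HColor.left r
  | m5 r => HColor.full r
  | b1 _ => HColor.blank
  | b2 _ => HColor.blank
  | b3 _ => HColor.blank

/-- The label of the shaded area whose left border crosses the tile, if there is one. -/
def startLabel : Tile L → Option L
  | t1 _ r | t2 r | m1 r | m2 _ r | b1 r => some r
  | t3 _ | t4 _ | m3 _ | m4 _ | m5 _ | b2 _ | b3 _ => none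

end Tile

/-! ### The local rules -/

section Rules

variable {A : Type*} [Fintype A] {σ : A → List A}

/-- Colours match on the edges of the tile in position `g`. -/
def Matching (x : BS12 → Tile (Label σ)) (g : BS12) : Prop :=
  (x g).rightEdge = (x (g * a)).leftEdge ∧
  (x g).botLeftEdge = (x (g * t)).topEdge ∧
  (x g).botRightEdge = (x (g * t * a)).topEdge

/-- The type of letter is uniform along the row `{g a^k}`. -/
def RowKind (x : BS12 → Tile (Label σ)) (g : BS12) : Prop :=
  (x g).kind = (x (g * a)).kind

/-- In its row, a shaded area with left border in position `u` has width `n`: the next left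
border to the right is in position `u a^n`. -/
def HasWidth (x : BS12 → Tile (Label σ)) (u : BS12) (n : ℕ) : Prop :=
  0 < n ∧ (x u).startLabel.isSome ∧ (x (u * a ^ n)).startLabel.isSome ∧
    ∀ j, 0 < j → j < n → (x (u * a ^ j)).startLabel = none

/-- Shaded areas have height `h` or `h - 1`: a top row is followed, downwards, by `h` or `h - 1`
middle rows and then by a bottom row, and there are never more than `h` consecutive middle
rows. -/
def Heights (h : ℕ) (x : BS12 → Tile (Label σ)) (g : BS12) : Prop :=
  ((x g).kind = Kind.top → ∃ m, (m = h ∨ m = h - 1) ∧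
    (∀ i, 1 ≤ i → i ≤ m → (x (g * t ^ i)).kind = Kind.mid) ∧
    (x (g * t ^ (m + 1))).kind = Kind.bot) ∧
  ∃ i ≤ h, (x (g * t ^ i)).kind ≠ Kind.mid

/-- Each tile of a row immediately below a top row belongs to a shaded area, labelled `(c,i)`
say, that has there a width between `lo c` and `hi c`. -/
def TopWidths (lo hi : A → ℕ) (x : BS12 → Tile (Label σ)) (g : BS12) : Prop :=
  (x g).kind = Kind.top → ∀ u, u = g * t ∨ u = g * t * a →
    ∃ s n : ℕ, ∃ l : Label σ, s < n ∧ (x (u * (a ^ s)⁻¹)).startLabel = some l ∧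
      lo l.1 ≤ n ∧ n ≤ hi l.1 ∧ HasWidth x (u * (a ^ s)⁻¹) n

/-- Synchronisation of the letters in `g`, `g t a t⁻¹` and `g t a⁻¹ t⁻¹`. -/
def Synchro (x : BS12 → Tile (Label σ)) (g : BS12) : Prop :=
  (∀ l r, x g = Tile.t1 l r →
    x (g * t * a * t⁻¹) = Tile.t2 r ∧ x (g * t * a⁻¹ * t⁻¹) = Tile.t4 l) ∧
  (∀ r, x g = Tile.b1 r →
    x (g * t * a * t⁻¹) = Tile.b1 r ∨ x (g * t * a⁻¹ * t⁻¹) = Tile.b1 r) ∧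
  (∀ r, x g = Tile.b3 r →
    x (g * t * a * t⁻¹) = Tile.b3 r ∨ x (g * t * a⁻¹ * t⁻¹) = Tile.b3 r) ∧
  (∀ r, x g = Tile.m1 r ↔ ∃ l, x (g * t * a⁻¹ * t⁻¹) = Tile.m2 l r)

/-- The tile in position `u` is crossed by the left border of a shaded area whose label has the
first index. -/
def IsFirst (x : BS12 → Tile (Label σ)) (u : BS12) : Prop :=
  ∃ l : Label σ, (x u).startLabel = some l ∧ l.2.val = 0

open Classical in
/-- Which of the two tiles `g t` and `g t a` below `g` is crossed by the left border of a shaded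
area whose label has the first index (`0` for `g t`, otherwise `1`). -/
noncomputable def firstChild (x : BS12 → Tile (Label σ)) (g : BS12) : ℕ :=
  if IsFirst x (g * t) then 0 else 1

/-- The labels of the left borders that cross the tiles `u a^e, ..., u a^(f-1)`, from left to
right. -/
def startLabels (x : BS12 → Tile (Label σ)) (u : BS12) (e f : ℕ) : List (A × ℕ) :=
  (List.range' e (f - e)).filterMap fun q =>
    ((x (u * a ^ q)).startLabel).map fun l => (l.1, l.2.val)

/-- Let a shaded area with label `(c,i)` occupy in a bottom row the positions
`g, g a, ..., g a^(n-1)`; then the shaded areas immediately below it, which extend from its left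
border to its right border, carry the labels `(c_1,1), ..., (c_k,k)` in this order, where
`σ(c) = c_1 ... c_k`. The bottom width `n` of a shaded area of height at most `h` and
top width at most `hi c` is at most `2^h * hi c`. -/
def Substitutes (h : ℕ) (hi : A → ℕ) (x : BS12 → Tile (Label σ)) (g : BS12) : Prop :=
  ∀ l : Label σ, x g = Tile.b1 l →
    (IsFirst x (g * t) ∨ IsFirst x (g * t * a)) ∧
    ∃ n ≤ 2 ^ h * hi l.1, HasWidth x g n ∧
      startLabels x (g * t) (firstChild x g) (2 * n + firstChild x (g * a ^ n)) =
        (σ l.1).zipIdx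

end Rules

section SFT

variable {A : Type*} [Fintype A]

/-- The SFT defined by the local rules, for shaded areas of heights `h` and `h - 1` and top widths
between `lo c` and `hi c`. -/
def tilingSFT (σ : A → List A) (h : ℕ) (lo hi : A → ℕ) : Set (BS12 → Tile (Label σ)) :=
  {x | ∀ g, Matching x g ∧ RowKind x g ∧ Heights h x g ∧ TopWidths lo hi x g ∧
    Synchro x g ∧ Substitutes h hi x g}

/-- The integer `h = ⌊log₂ λ⌋ - 1`. -/
noncomputable def heightParam (lam : ℝ) : ℕ := ⌊Real.logb 2 lam⌋₊ - 1

/-- The integers `w_c = ⌊v(c)⌋ - 1`. -/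
noncomputable def widthParam (v : A → ℝ) (c : A) : ℕ := ⌊v c⌋₊ - 1

/-- The SFT `X_σ`: heights `h - 1` and `h`, top widths from `w_c - 1` to `2 w_c - 1`. -/
noncomputable def XSigma (σ : A → List A) (lam : ℝ) (v : A → ℝ) : Set (BS12 → Tile (Label σ)) :=
  tilingSFT σ (heightParam lam) (fun c => widthParam v c - 1) (fun c => 2 * widthParam v c - 1)

end SFT

end BSTiling

namespace BSTiling

/-! ### Relations in `BS(1,2)` -/

/-! The group is cut into sheets `s t^d a^m`. In a sheet, the tile of row `d` at `m` lies above the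
tiles of row `d + 1` at `2m` and `2m + 1`. The boundary region of a rectangle meets each sheet in
its highest rows, its lowest rows and a left and a right margin of every row. The point is that
these determine the rows in between, for a thickness that does not depend on `k` and `l`. Two passes
over the rows achieve this.

Downwards, one follows words of labels. A left border runs unchanged through top and middle rows,
and below a bottom row the substitution replaces each label by a word. Hence the word of row `d`
determines the word of row `d + 1`, up to what happens near the two ends. There the tiles are known,
and the margins are wide enough to contain a left border, since the gaps between left borders of
bottom rows are bounded (`denseRow`, `seg_succ_eq`).

Upwards, one recovers the tiles. The bottom edges of a top or middle row are seen from the row below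
and fix its letters. The bottom edges of a bottom row are blank, so its labels cannot be seen this
way. But its left borders lie exactly above those whose label has the first index, so the row below
gives their positions, and the downward pass gives their labels (`row_eq_of_succ`).

So there are at most as many patterns as colourings of the boundary region, whose share of the
rectangle tends to `0`; hence the entropy is `0`. The set is an SFT because the bounds on widths and
heights confine every rule to a finite window. -/

theorem semiconjBy_t : SemiconjBy t (a ^ 2) a := by
  have h : (PresentedGroup.mk rels) ((FreeGroup.of Gen.t)⁻¹ * FreeGroup.of Gen.a *
      FreeGroup.of Gen.t * (FreeGroup.of Gen.a ^ 2)⁻¹) = 1 :=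
    PresentedGroup.one_of_mem (Set.mem_singleton _)
  have h' : t⁻¹ * a * t * (a ^ 2)⁻¹ = 1 := by
    simp only [map_mul, map_inv, map_pow] at h
    exact h
  have h2 : t⁻¹ * a * t = a ^ 2 := mul_inv_eq_one.1 h'
  show t * a ^ 2 = a * t
  rw [← h2]; group

theorem zpow_a_mul_t (m : ℤ) : a ^ m * t = t * a ^ (2 * m) := by
  have h := (semiconjBy_t.zpow_right m).eq
  rw [← h, zpow_mul]; rfl

theorem zpow_a_mul_t_pow (m : ℤ) (d : ℕ) : a ^ m * t ^ d = t ^ d * a ^ (2 ^ d * m) := by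
  induction d generalizing m with
  | zero => simp
  | succ d ih =>
    rw [pow_succ, ← mul_assoc, ih, mul_assoc, zpow_a_mul_t, mul_assoc]
    congr 3; ring

/-! ### Local rules define subshifts of finite type -/

/-- The forbidden patterns are those on `S` that are never read at a place where `R` holds. As `S`
decides `R`, avoiding them amounts to `R` everywhere; there are finitely many since `S` and `B` are
finite. -/
theorem isSFT_of_window {G B : Type*} [Group G] [Finite B] (R : (G → B) → G → Prop) (S : Finset G)
    (hR : ∀ x g y g', (∀ w ∈ S, x (g * w) = y (g' * w)) → R x g → R y g') :
    IsSFT {x : G → B | ∀ g, R x g} := by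
  refine ⟨(fun p : S → B => (⟨S, p⟩ : Σ S : Finset G, (S → B))) ''
    {p | ¬ ∃ x g, R x g ∧ ∀ w : S, x (g * w) = p w}, (Set.toFinite _).image _, ?_⟩
  ext x
  constructor
  · rintro hx _ ⟨p, hp, rfl⟩ ⟨g, hg⟩
    exact hp ⟨x, g⁻¹, hx _, fun w => (hg w).symm⟩
  · intro hx g
    by_contra hg
    refine hx ⟨S, fun w => x (g * w)⟩ ⟨_, ?_, rfl⟩ ⟨g⁻¹, fun w => by simp [shift]⟩
    rintro ⟨y, g', hy, hyw⟩
    exact hg (hR y g' x g (fun w hw => hyw ⟨w, hw⟩) hy)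

theorem finite_tile {L : Type*} [Finite L] : Finite (Tile L) := by
  refine Finite.of_surjective (fun p : Fin 12 × L × L =>
    (![Tile.t1 p.2.1 p.2.2, Tile.t2 p.2.2, Tile.t3 p.2.2, Tile.t4 p.2.2, Tile.m1 p.2.2,
      Tile.m2 p.2.1 p.2.2, Tile.m3 p.2.2, Tile.m4 p.2.2, Tile.m5 p.2.2, Tile.b1 p.2.2,
      Tile.b2 p.2.2, Tile.b3 p.2.2] : Fin 12 → Tile L) p.1) ?_
  rintro (⟨l, r⟩ | r | r | r | r | ⟨l, r⟩ | r | r | r | r | r | r)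
  exacts [⟨(0, l, r), rfl⟩, ⟨(1, r, r), rfl⟩, ⟨(2, r, r), rfl⟩, ⟨(3, r, r), rfl⟩,
    ⟨(4, r, r), rfl⟩, ⟨(5, l, r), rfl⟩, ⟨(6, r, r), rfl⟩, ⟨(7, r, r), rfl⟩, ⟨(8, r, r), rfl⟩,
    ⟨(9, r, r), rfl⟩, ⟨(10, r, r), rfl⟩, ⟨(11, r, r), rfl⟩]

section Window

variable {A : Type*} [Fintype A] {σ : A → List A}

theorem HasWidth.congr {x y : BS12 → Tile (Label σ)} {u u' : BS12} {n : ℕ}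
    (h : ∀ j ≤ n, x (u * a ^ j) = y (u' * a ^ j)) (hx : HasWidth x u n) : HasWidth y u' n := by
  obtain ⟨h0, h1, h2, h3⟩ := hx
  have h00 := h 0 (Nat.zero_le _)
  simp only [pow_zero, mul_one] at h00
  refine ⟨h0, h00 ▸ h1, h n le_rfl ▸ h2, fun j hj hjn => ?_⟩
  rw [← h j hjn.le]; exact h3 j hj hjn

theorem IsFirst.congr {x y : BS12 → Tile (Label σ)} {u u' : BS12} (h : x u = y u') :
    IsFirst x u ↔ IsFirst y u' := by
  simp only [IsFirst, h]

theorem firstChild_congr {x y : BS12 → Tile (Label σ)} {g g' : BS12}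
    (h : x (g * t) = y (g' * t)) : firstChild x g = firstChild y g' := by
  have hF : IsFirst x (g * t) ↔ IsFirst y (g' * t) := IsFirst.congr h
  by_cases h1 : IsFirst x (g * t)
  · rw [firstChild, firstChild, if_pos h1, if_pos (hF.1 h1)]
  · rw [firstChild, firstChild, if_neg h1, if_neg (mt hF.2 h1)]

theorem firstChild_le_one (x : BS12 → Tile (Label σ)) (g : BS12) : firstChild x g ≤ 1 := by
  unfold firstChild; split_ifs <;> simp

theorem startLabels_congr {x y : BS12 → Tile (Label σ)} {u u' : BS12} {e f : ℕ}
    (h : ∀ q ≤ f, x (u * a ^ q) = y (u' * a ^ q)) :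
    startLabels x u e f = startLabels y u' e f := by
  unfold startLabels
  refine List.filterMap_congr fun q hq => ?_
  rw [List.mem_range'_1] at hq
  rw [h q (by omega)]

/-- The conjunction of the local rules in position `g`. -/
def Rules (h : ℕ) (lo hi : A → ℕ) (x : BS12 → Tile (Label σ)) (g : BS12) : Prop :=
  Matching x g ∧ RowKind x g ∧ Heights h x g ∧ TopWidths lo hi x g ∧
    Synchro x g ∧ Substitutes h hi x g

open Classical in
/-- A finite window that contains all positions a local rule refers to. -/
noncomputable def window (h K : ℕ) : Finset BS12 :=
  (Finset.range (h + 2)).image (fun i => t ^ i) ∪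
    (Finset.Icc (-(K : ℤ)) K).image (fun j => a ^ j) ∪
    (Finset.Icc (-(K : ℤ)) K).image (fun j => t * a ^ j) ∪ {t * a * t⁻¹, t * a⁻¹ * t⁻¹}

/-- The bound on `K` covers the longest reaches along a row: top widths reach at most `H` to either
side of `g t` or `g t a`, and a shaded area of bottom width `n ≤ 2 ^ h * H` involves the `2n + 1`
positions below it and one more. -/
theorem rules_congr {h : ℕ} {lo hi : A → ℕ} {x y : BS12 → Tile (Label σ)} {g g' : BS12} {H K : ℕ}
    (hH : ∀ c, hi c ≤ H) (hK : 2 * (2 ^ h * H) + H + 2 ≤ K)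
    (hw : ∀ w ∈ window h K, x (g * w) = y (g' * w)) (hx : Rules h lo hi x g) :
    Rules h lo hi y g' := by
  have ht : ∀ i ≤ h + 1, x (g * t ^ i) = y (g' * t ^ i) := fun i hi => by
    apply hw; simp only [window, Finset.mem_union, Finset.mem_image, Finset.mem_range]
    exact Or.inl (Or.inl (Or.inl ⟨i, by omega, rfl⟩))
  have ha : ∀ j : ℤ, -K ≤ j → j ≤ K → x (g * a ^ j) = y (g' * a ^ j) := fun j h1 h2 => by
    apply hw; simp only [window, Finset.mem_union, Finset.mem_image, Finset.mem_Icc]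
    exact Or.inl (Or.inl (Or.inr ⟨j, ⟨h1, h2⟩, rfl⟩))
  have hta : ∀ j : ℤ, -K ≤ j → j ≤ K → x (g * (t * a ^ j)) = y (g' * (t * a ^ j)) :=
    fun j h1 h2 => by
      apply hw; simp only [window, Finset.mem_union, Finset.mem_image, Finset.mem_Icc]
      exact Or.inl (Or.inr ⟨j, ⟨h1, h2⟩, rfl⟩)
  have e0 : x g = y g' := by simpa using ht 0 (by omega)
  have e1 : x (g * t) = y (g' * t) := by simpa using ht 1 (by omega)
  have e2 : x (g * a) = y (g' * a) := by simpa using ha 1 (by omega) (by omega)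
  have e3 : x (g * t * a) = y (g' * t * a) := by
    simpa [mul_assoc] using hta 1 (by omega) (by omega)
  have e4 : x (g * t * a * t⁻¹) = y (g' * t * a * t⁻¹) := by
    simpa [mul_assoc] using hw (t * a * t⁻¹) (by simp [window])
  have e5 : x (g * t * a⁻¹ * t⁻¹) = y (g' * t * a⁻¹ * t⁻¹) := by
    simpa [mul_assoc] using hw (t * a⁻¹ * t⁻¹) (by simp [window])
  obtain ⟨h1, h2, h3, h4, h5, h6⟩ := hx
  refine ⟨?_, ?_, ?_, ?_, ?_, ?_⟩
  · simpa only [Matching, e0, e1, e2, e3] using h1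
  · simpa only [RowKind, e0, e2] using h2
  · refine ⟨fun hk => ?_, ?_⟩
    · obtain ⟨m, hm, hmid, hbot⟩ := h3.1 (e0 ▸ hk)
      refine ⟨m, hm, fun i hi1 him => ?_, ?_⟩
      · rw [← ht i (by omega)]; exact hmid i hi1 him
      · rw [← ht (m + 1) (by omega)]; exact hbot
    · obtain ⟨i, hi, hne⟩ := h3.2
      exact ⟨i, hi, ht i (by omega) ▸ hne⟩
  · have key : ∀ ε : ℤ, 0 ≤ ε → ε ≤ 1 → ∀ s n : ℕ, ∀ l : Label σ, s < n →
        (x (g * (t * a ^ ε) * (a ^ s)⁻¹)).startLabel = some l → lo l.1 ≤ n → n ≤ hi l.1 →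
        HasWidth x (g * (t * a ^ ε) * (a ^ s)⁻¹) n →
        ∃ s n : ℕ, ∃ l : Label σ, s < n ∧
          (y (g' * (t * a ^ ε) * (a ^ s)⁻¹)).startLabel = some l ∧
          lo l.1 ≤ n ∧ n ≤ hi l.1 ∧ HasWidth y (g' * (t * a ^ ε) * (a ^ s)⁻¹) n := by
      intro ε hε0 hε1 s n l hs hl hlo hhi hW
      have hnH := hhi.trans (hH l.1)
      have hj : ∀ j ≤ n, x (g * (t * a ^ ε) * (a ^ s)⁻¹ * a ^ j) =
          y (g' * (t * a ^ ε) * (a ^ s)⁻¹ * a ^ j) := by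
        intro j hj
        have := hta (ε - s + j) (by omega) (by omega)
        simpa only [zpow_add, zpow_sub, zpow_natCast, mul_assoc] using this
      refine ⟨s, n, l, hs, ?_, hlo, hhi, hW.congr hj⟩
      have := hj 0 (Nat.zero_le _)
      simp only [pow_zero, mul_one] at this
      rw [← this]; exact hl
    intro hk u hu
    have hk' := h4 (e0 ▸ hk)
    rcases hu with rfl | rfl
    · obtain ⟨s, n, l, hs, hl, hlo, hhi, hW⟩ := hk' (g * t) (Or.inl rfl)
      simpa using key 0 le_rfl (by norm_num) s n l hs (by simpa using hl) hlo hhi (by simpa using hW)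
    · obtain ⟨s, n, l, hs, hl, hlo, hhi, hW⟩ := hk' (g * t * a) (Or.inr rfl)
      simpa [mul_assoc] using key 1 (by norm_num) le_rfl s n l hs (by simpa [mul_assoc] using hl)
        hlo hhi (by simpa [mul_assoc] using hW)
  · simpa only [Synchro, e0, e4, e5] using h5
  · intro l hl
    obtain ⟨hF, n, hn, hW, hL⟩ := h6 l (e0.trans hl)
    have hnH : n ≤ 2 ^ h * H := hn.trans (Nat.mul_le_mul_left _ (hH _))
    refine ⟨?_, n, hn, hW.congr fun j hj => ?_, ?_⟩
    · simpa only [IsFirst.congr e1, IsFirst.congr e3] using hF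
    · simpa using ha j (by omega) (by omega)
    · have hfn : firstChild x (g * a ^ n) = firstChild y (g' * a ^ n) := by
        refine firstChild_congr ?_
        have h1 := hta (2 * n) (by omega) (by omega)
        rw [← zpow_a_mul_t] at h1
        simpa [mul_assoc] using h1
      rw [← hL, firstChild_congr e1, hfn]
      have hle := firstChild_le_one y (g' * a ^ n)
      refine (startLabels_congr fun q hq => ?_).symm
      simpa [mul_assoc] using hta q (by omega) (by omega)

theorem isSFT_tilingSFT (h : ℕ) (lo hi : A → ℕ) : IsSFT (tilingSFT σ h lo hi) := by
  have : Finite (Tile (Label σ)) := finite_tile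
  exact isSFT_of_window (Rules h lo hi)
    (window h (2 * (2 ^ h * Finset.univ.sup hi) + Finset.univ.sup hi + 2))
    fun x g y g' hw hx => rules_congr (fun c => Finset.le_sup (Finset.mem_univ c)) le_rfl hw hx

end Window

/-! ### Sizes of the rectangles and of their boundary regions -/

/-- The action of `BS(1,2)` on the rational numbers by `a z = z + 1` and `t z = z / 2`. -/
noncomputable def affineAction : BS12 →* Equiv.Perm ℚ :=
  PresentedGroup.toGroup (f := fun g => match g with
    | Gen.a => Equiv.addRight (1 : ℚ)
    | Gen.t => (Equiv.mulRight₀ (2 : ℚ) two_ne_zero)⁻¹) (by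
    rintro _ rfl
    ext z
    simp [pow_two]
    ring)

theorem affineAction_t_inv (z : ℚ) : affineAction t⁻¹ z = z * 2 := by
  simp [affineAction, t]

theorem affineAction_a (z : ℚ) : affineAction a z = z + 1 := by
  simp [affineAction, a]

theorem affineAction_a_pow (i : ℕ) (z : ℚ) : affineAction (a ^ i) z = z + i := by
  induction i with
  | zero => simp
  | succ i ih =>
    rw [pow_succ', map_mul, Equiv.Perm.mul_apply, ih, affineAction_a]; push_cast; ring

theorem affineAction_t_pow_inv (j : ℕ) (z : ℚ) : affineAction (t ^ j)⁻¹ z = z * 2 ^ j := by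
  induction j with
  | zero => simp
  | succ j ih =>
    rw [pow_succ, mul_inv_rev, map_mul, Equiv.Perm.mul_apply, affineAction_t_inv, ih]; ring

/-- After cancelling `t ^ l`, the element acts on `ℚ` as `z ↦ 2 ^ j z + i`; its values at `0` and
`1` give `i` and `j`. -/
theorem rect_param_injective (l : ℕ) :
    Function.Injective fun q : ℕ × ℕ => t ^ l * a ^ q.1 * (t ^ q.2)⁻¹ := by
  rintro ⟨i, j⟩ ⟨i', j'⟩ h
  have h1 : a ^ i * (t ^ j)⁻¹ = a ^ i' * (t ^ j')⁻¹ := by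
    simpa [mul_assoc] using h
  have h2 : ∀ z : ℚ, z * 2 ^ j + i = z * 2 ^ j' + i' := by
    intro z
    have := congrArg (fun g => affineAction g z) h1
    simpa only [map_mul, Equiv.Perm.mul_apply, affineAction_a_pow, affineAction_t_pow_inv]
      using this
  have hi : i = i' := by have := h2 0; simpa using this
  subst hi
  have hj : (2 : ℚ) ^ j = 2 ^ j' := by simpa using h2 1
  have hj' : (2 : ℕ) ^ j = 2 ^ j' := by exact_mod_cast hj
  rw [Nat.pow_right_injective le_rfl hj']

theorem card_rect (k l : ℕ) : (rect k l).card = (k + 1) * 2 ^ l / 2 * (l + 1) := by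
  classical
  rw [rect, Finset.card_image_of_injective _ (rect_param_injective l), Finset.card_product,
    Finset.card_range, Finset.card_range]

theorem rectBoundary_subset_rect (c k l : ℕ) : rectBoundary c k l ⊆ rect k l := by
  classical exact Finset.image_subset_image (Finset.filter_subset _ _)

/-- At most `2 (c + 1)` levels of full width, and two strips of `2 ^ l` columns across all `l + 2`
levels. Writing `l + 1` for the height makes the halving in the width exact. -/
theorem card_rectBoundary_le (c k l : ℕ) :
    (rectBoundary c k (l + 1)).card ≤
      2 * (c + 1) * ((k + 1) * 2 ^ l) + 2 * 2 ^ l * (l + 2) := by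
  classical
  have hW : (k + 1) * 2 ^ (l + 1) / 2 = (k + 1) * 2 ^ l := by
    rw [pow_succ, ← mul_assoc, Nat.mul_div_cancel _ two_pos]
  refine Finset.card_image_le.trans ?_
  rw [hW]
  have hsub : ((Finset.range ((k + 1) * 2 ^ l) ×ˢ Finset.range (l + 1 + 1)).filter
      fun q => q.2 ≤ c ∨ l + 1 ≤ q.2 + c ∨ 2 * q.1 < 2 ^ (l + 1) ∨ k * 2 ^ (l + 1) ≤ 2 * q.1) ⊆
      Finset.range ((k + 1) * 2 ^ l) ×ˢ (Finset.range (c + 1) ∪ Finset.Icc (l + 1 - c) (l + 1)) ∪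
      (Finset.range (2 ^ l) ∪ Finset.Ico (k * 2 ^ l) ((k + 1) * 2 ^ l)) ×ˢ
        Finset.range (l + 1 + 1) := by
    rintro ⟨i, j⟩ hq
    simp only [Finset.mem_filter, Finset.mem_product, Finset.mem_range, Finset.mem_union,
      Finset.mem_Icc, Finset.mem_Ico, pow_succ, ← mul_assoc] at hq ⊢
    omega
  refine (Finset.card_le_card hsub).trans ((Finset.card_union_le _ _).trans ?_)
  rw [Finset.card_product, Finset.card_product, Finset.card_range, Finset.card_range]
  have h1 := Finset.card_union_le (Finset.range (c + 1)) (Finset.Icc (l + 1 - c) (l + 1))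
  have h2 := Finset.card_union_le (Finset.range (2 ^ l))
    (Finset.Ico (k * 2 ^ l) ((k + 1) * 2 ^ l))
  rw [Finset.card_range, Nat.card_Icc] at h1
  rw [Finset.card_range, Nat.card_Ico, ← Nat.sub_mul] at h2
  have h3 : (Finset.range (c + 1) ∪ Finset.Icc (l + 1 - c) (l + 1)).card ≤ 2 * (c + 1) := by omega
  have h4 : (Finset.range (2 ^ l) ∪ Finset.Ico (k * 2 ^ l) ((k + 1) * 2 ^ l)).card ≤
      2 * 2 ^ l := by
    rw [show k + 1 - k = 1 by omega] at h2; omega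
  have h5 := Nat.mul_le_mul_left ((k + 1) * 2 ^ l) h3
  have h6 := Nat.mul_le_mul_right (l + 1 + 1) h4
  rw [mul_comm (2 * (c + 1))]
  exact Nat.add_le_add h5 h6

/-- For `l ≥ 1`, the bound on the boundary divided by the size of the rectangle is exactly `2 (c +
1) / (l + 1) + 2 / (k + 1)`. -/
theorem tendsto_card_rectBoundary_div (c : ℕ) :
    Filter.Tendsto (fun q : ℕ × ℕ => ((rectBoundary c q.1 q.2).card : ℝ) /
      ((rect q.1 q.2).card : ℝ)) (Filter.atTop ×ˢ Filter.atTop) (nhds 0) := by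
  have h1 : Filter.Tendsto (fun q : ℕ × ℕ => (2 * (c + 1) : ℝ) / ((q.2 : ℝ) + 1) +
      2 / ((q.1 : ℝ) + 1)) (Filter.atTop ×ˢ Filter.atTop) (nhds (0 + 0)) := by
    have h0 : ∀ C : ℝ, Filter.Tendsto (fun n : ℕ => C / ((n : ℝ) + 1)) Filter.atTop (nhds 0) :=
      fun C => Filter.Tendsto.div_atTop tendsto_const_nhds
        (Filter.tendsto_atTop_add_const_right _ _ tendsto_natCast_atTop_atTop)
    exact ((h0 _).comp Filter.tendsto_snd).add ((h0 _).comp Filter.tendsto_fst)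
  rw [add_zero] at h1
  refine squeeze_zero' (Filter.Eventually.of_forall fun q => by positivity) ?_ h1
  have hl : ∀ᶠ q : ℕ × ℕ in Filter.atTop ×ˢ Filter.atTop, 1 ≤ q.2 :=
    Filter.tendsto_snd.eventually (Filter.eventually_ge_atTop 1)
  filter_upwards [hl] with q hq
  obtain ⟨k, l'⟩ := q
  obtain ⟨l, rfl⟩ : ∃ l, l' = l + 1 := ⟨l' - 1, by simp at hq; omega⟩
  have hW : (k + 1) * 2 ^ (l + 1) / 2 = (k + 1) * 2 ^ l := by
    rw [pow_succ, ← mul_assoc, Nat.mul_div_cancel _ two_pos]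
  have hle : ((rectBoundary c k (l + 1)).card : ℝ) ≤
      2 * (c + 1) * ((k + 1) * 2 ^ l) + 2 * 2 ^ l * (l + 2) := by
    exact_mod_cast card_rectBoundary_le c k l
  simp only [card_rect, hW]
  push_cast
  rw [div_le_iff₀ (by positivity)]
  refine hle.trans (le_of_eq ?_)
  have hk : (k : ℝ) + 1 ≠ 0 := by positivity
  have hl2 : (l : ℝ) + 1 + 1 ≠ 0 := by positivity
  field_simp
  ring

/-! ### Patterns determined by the boundary region -/

theorem ncard_language_le {B : Type*} [Finite B] {X : Set (BS12 → B)} {c k l : ℕ}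
    (h : DeterminedByBoundary X c k l) :
    (language X k l).ncard ≤ Nat.card B ^ (rectBoundary c k l).card := by
  have h1 : (language X k l).ncard ≤ (Set.univ : Set (rectBoundary c k l → B)).ncard := by
    refine Set.ncard_le_ncard_of_injOn
      (fun p w => p ⟨w.1, rectBoundary_subset_rect c k l w.2⟩) (fun _ _ => Set.mem_univ _) ?_
      (Set.toFinite _)
    intro p hp q hq hpq
    exact h p hp q hq fun g hg => congrFun hpq ⟨g, hg⟩
  rwa [Set.ncard_univ, Nat.card_fun, Nat.card_eq_fintype_card (α := rectBoundary c k l),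
    Fintype.card_coe] at h1

theorem hasEntropy_zero_of_determined {B : Type*} [Finite B] {X : Set (BS12 → B)} {c : ℕ}
    (h : ∀ k l, DeterminedByBoundary X c k l) : HasEntropy X 0 := by
  have h1 := (tendsto_card_rectBoundary_div c).mul_const (Real.log (Nat.card B))
  rw [zero_mul] at h1
  refine squeeze_zero (fun q => div_nonneg (Real.log_natCast_nonneg _) (Nat.cast_nonneg _))
    (fun q => ?_) h1
  rw [div_mul_eq_mul_div]
  refine div_le_div_of_nonneg_right ?_ (Nat.cast_nonneg _)
  rw [← Real.log_pow]
  -- For an empty language `log 0 = 0` still satisfies the bound.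
  rcases Nat.eq_zero_or_pos (language X q.1 q.2).ncard with h0 | h0
  · rw [h0, Nat.cast_zero, Real.log_zero, ← Nat.cast_pow]
    exact Real.log_natCast_nonneg _
  · refine Real.log_le_log (by exact_mod_cast h0) ?_
    exact_mod_cast ncard_language_le (h q.1 q.2)

/-! ### Words read along an interval of integers -/

section Seg

variable {γ : Type*}

/-- The word of the values of `F` on `[A, B)`, from left to right. -/
def seg (F : ℤ → Option γ) (A B : ℤ) : List γ :=
  (List.range (B - A).toNat).filterMap fun q : ℕ => F (A + q)

theorem seg_self (F : ℤ → Option γ) (A : ℤ) : seg F A A = [] := by simp [seg]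

theorem seg_succ (F : ℤ → Option γ) (A : ℤ) : seg F A (A + 1) = (F A).toList := by
  have : (A + 1 - A).toNat = 1 := by omega
  simp only [seg, this, List.range_one]
  cases h : F A <;> simp [h]

theorem seg_append (F : ℤ → Option γ) {A B C : ℤ} (h1 : A ≤ B) (h2 : B ≤ C) :
    seg F A C = seg F A B ++ seg F B C := by
  obtain ⟨n, rfl⟩ := Int.le.dest h1
  obtain ⟨m, rfl⟩ := Int.le.dest h2
  have e1 : (A + n + m - A).toNat = n + m := by omega
  have e2 : (A + n - A).toNat = n := by omega
  have e3 : (A + n + m - (A + n)).toNat = m := by omega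
  simp only [seg, e1, e2, e3, List.range_add, List.filterMap_append, List.filterMap_map]
  congr 1
  refine List.filterMap_congr fun q _ => ?_
  simp only [Function.comp]
  push_cast
  rw [add_assoc]

theorem seg_congr {F G : ℤ → Option γ} {A B : ℤ} (h : ∀ j, A ≤ j → j < B → F j = G j) :
    seg F A B = seg G A B :=
  List.filterMap_congr fun q hq => h _ (by omega) (by rw [List.mem_range] at hq; omega)

theorem seg_eq_nil {F : ℤ → Option γ} {A B : ℤ} (h : ∀ j, A ≤ j → j < B → F j = none) :
    seg F A B = [] := by
  rw [seg, List.filterMap_eq_nil_iff]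
  exact fun q hq => h _ (by omega) (by rw [List.mem_range] at hq; omega)

theorem seg_eq_toList {F : ℤ → Option γ} {A B : ℤ} (hAB : A < B)
    (h : ∀ j, A < j → j < B → F j = none) : seg F A B = (F A).toList := by
  rw [seg_append F (B := A + 1) (by omega) (by omega), seg_succ,
    seg_eq_nil fun j h1 h2 => h j (by omega) h2, List.append_nil]

theorem mem_seg {F : ℤ → Option γ} {A B j : ℤ} {p : γ} (h1 : A ≤ j) (h2 : j < B)
    (h : F j = some p) : p ∈ seg F A B := by
  rw [seg_append F h1 h2.le, seg_append F (A := j) (B := j + 1) (by omega) (by omega), seg_succ, h]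
  simp

/-- Common prefixes and suffixes cancel. This moves equalities of words between a whole row and an
interval whose ends can be chosen freely in the known margins. -/
theorem seg_eq_iff_of_margins {F G : ℤ → Option γ} {L A B R : ℤ} (h1 : L ≤ A) (h2 : A ≤ B)
    (h3 : B ≤ R) (hl : ∀ j, L ≤ j → j < A → F j = G j) (hr : ∀ j, B ≤ j → j < R → F j = G j) :
    seg F L R = seg G L R ↔ seg F A B = seg G A B := by
  rw [seg_append F h1 (h2.trans h3), seg_append G h1 (h2.trans h3), seg_append F h2 h3,
    seg_append G h2 h3, seg_congr hl, seg_congr hr, List.append_right_inj, List.append_left_inj]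

theorem seg_double {F G : ℤ → Option γ}
    (h : ∀ j, (G (2 * j)).toList ++ (G (2 * j + 1)).toList = (F j).toList) {A B : ℤ}
    (hAB : A ≤ B) : seg G (2 * A) (2 * B) = seg F A B := by
  obtain ⟨n, rfl⟩ := Int.le.dest hAB
  clear hAB
  induction n with
  | zero => simp [seg_self]
  | succ n ih =>
    push_cast
    rw [seg_append F (B := A + n) (by omega) (by omega),
      seg_append G (B := 2 * (A + n)) (by omega) (by omega), ih, ← add_assoc, seg_succ, ← h,
      seg_append G (B := 2 * (A + n) + 1) (by omega) (by omega), seg_succ,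
      show 2 * (A + n + 1) = 2 * (A + n) + 1 + 1 by ring, seg_succ]

theorem eq_of_filterMap_eq {ι : Type*} {F G : ι → Option γ} {l : List ι}
    (hs : ∀ j ∈ l, (F j).isSome = (G j).isSome) (h : l.filterMap F = l.filterMap G) :
    ∀ j ∈ l, F j = G j := by
  induction l with
  | nil => simp
  | cons i l ih =>
    have hi := hs i (by simp)
    have hs' : ∀ j ∈ l, (F j).isSome = (G j).isSome := fun j hj => hs j (by simp [hj])
    rw [List.forall_mem_cons]
    cases hF : F i with
    | none =>
      cases hG : G i with
      | none =>
        rw [List.filterMap_cons_none hF, List.filterMap_cons_none hG] at h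
        exact ⟨rfl, ih hs' h⟩
      | some q => simp [hF, hG] at hi
    | some p =>
      cases hG : G i with
      | none => simp [hF, hG] at hi
      | some q =>
        rw [List.filterMap_cons_some hF, List.filterMap_cons_some hG, List.cons.injEq] at h
        exact ⟨by rw [h.1], ih hs' h.2⟩

/-- A word together with the positions of its letters fixes every value. In bottom rows the
positions will come from below and the word from above. -/
theorem eq_of_seg_eq {F G : ℤ → Option γ} {A B : ℤ}
    (hs : ∀ j, A ≤ j → j < B → (F j).isSome = (G j).isSome) (h : seg F A B = seg G A B) :
    ∀ j, A ≤ j → j < B → F j = G j := by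
  intro j h1 h2
  have := eq_of_filterMap_eq (F := fun q : ℕ => F (A + q)) (G := fun q : ℕ => G (A + q))
    (l := List.range (B - A).toNat) (fun q hq => hs _ (by omega)
    (by rw [List.mem_range] at hq; omega)) h (j - A).toNat (by rw [List.mem_range]; omega)
  rwa [show A + ((j - A).toNat : ℤ) = j by omega] at this

end Seg

/-! ### The letters -/

section Letters

variable {L : Type*}

/-- The label of the left border that meets a horizontal edge. -/
def HColor.start : HColor L → Option L
  | HColor.right r => some r
  | _ => none

theorem Tile.topEdge_eq_blank_iff (T : Tile L) : T.topEdge = HColor.blank ↔ T.kind = Kind.top := by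
  cases T <;> simp [Tile.topEdge, Tile.kind]

theorem Tile.botLeftEdge_eq_blank_iff (T : Tile L) :
    T.botLeftEdge = HColor.blank ↔ T.kind = Kind.bot := by
  cases T <;> simp [Tile.botLeftEdge, Tile.kind]

theorem Tile.start_topEdge {T : Tile L} (h : T.kind ≠ Kind.top) :
    T.topEdge.start = T.startLabel := by
  cases T <;> simp_all [Tile.topEdge, Tile.kind, Tile.startLabel, HColor.start]

/-- A left border leaves a top or middle tile through exactly one of its two bottom edges, the one
coloured `right`; by `start_topEdge` it then enters the tile below that edge. -/
theorem Tile.start_bottom {T : Tile L} (h : T.kind ≠ Kind.bot) :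
    T.botLeftEdge.start.toList ++ T.botRightEdge.start.toList = T.startLabel.toList := by
  cases T <;> simp_all [Tile.botLeftEdge, Tile.botRightEdge, Tile.kind, Tile.startLabel,
    HColor.start]

theorem Tile.eq_b1_of_startLabel {T : Tile L} (h : T.kind = Kind.bot) {r : L}
    (hr : T.startLabel = some r) : T = Tile.b1 r := by
  cases T <;> simp_all [Tile.kind, Tile.startLabel]

/-- A top or middle letter is determined by its type, its bottom edges and the bottom left edge of
its right neighbour. -/
theorem Tile.eq_of_bottom {T T' U U' : Tile L} (hk : T.kind = T'.kind) (hb : T.kind ≠ Kind.bot)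
    (hl : T.botLeftEdge = T'.botLeftEdge) (hr : T.botRightEdge = T'.botRightEdge)
    (h : T.rightEdge = U.leftEdge) (h' : T'.rightEdge = U'.leftEdge) (hU : U.kind = T.kind)
    (hU' : U'.kind = T'.kind) (hUU : U.botLeftEdge = U'.botLeftEdge) : T = T' := by
  -- Type and bottom edges leave only `m3` and `m5` to be distinguished: the right neighbour of `m3`
  -- has a `full` bottom left edge, that of `m5` is `m2`, whose bottom left edge is `left`.
  cases T <;> cases T' <;>
    simp only [Tile.kind, Tile.botLeftEdge, Tile.botRightEdge, reduceCtorEq, ne_eq,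
      not_true_eq_false, HColor.left.injEq, HColor.right.injEq, HColor.full.injEq] at hk hb hl hr <;>
    (try subst hl) <;> (try subst hr) <;> (try rfl) <;>
    cases U <;> simp only [Tile.kind, Tile.rightEdge, Tile.leftEdge, reduceCtorEq] at h hU <;>
    cases U' <;> simp only [Tile.kind, Tile.rightEdge, Tile.leftEdge, Tile.botLeftEdge,
      reduceCtorEq] at h' hU' hUU

/-- A bottom letter is determined by its left edge, its left border and the existence of a left
border in its right neighbour. -/
theorem Tile.eq_of_left {T T' U U' : Tile L} (hk : T.kind = Kind.bot) (hk' : T'.kind = Kind.bot)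
    (hl : T.leftEdge = T'.leftEdge) (hs : T.startLabel = T'.startLabel)
    (h : T.rightEdge = U.leftEdge) (h' : T'.rightEdge = U'.leftEdge) (hU : U.kind = Kind.bot)
    (hU' : U'.kind = Kind.bot) (hUU : U.startLabel.isSome = U'.startLabel.isSome) : T = T' := by
  -- The only ambiguity is between `b2` and `b3`: a left border follows `b3` but not `b2`.
  cases T <;> simp only [Tile.kind, reduceCtorEq] at hk <;>
    cases T' <;> simp only [Tile.kind, Tile.leftEdge, Tile.startLabel, reduceCtorEq,
      VColor.upper.injEq, Option.some.injEq] at hk' hl hs <;>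
    (try subst hl) <;> (try subst hs) <;> (try rfl) <;>
    cases U <;> simp only [Tile.kind, Tile.rightEdge, Tile.leftEdge, reduceCtorEq] at h hU <;>
    cases U' <;> simp only [Tile.kind, Tile.rightEdge, Tile.leftEdge, Tile.startLabel,
      reduceCtorEq, Option.isSome_some, Option.isSome_none] at h' hU' hUU

end Letters

/-! ### Sheets -/

section Sheet

variable {A : Type*} [Fintype A] {σ : A → List A}

/-- The label of the left border that crosses a tile, with its index as a natural number. -/
def borderLabel (T : Tile (Label σ)) : Option (A × ℕ) :=
  T.startLabel.map fun l => (l.1, l.2.val)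

theorem isSome_borderLabel (T : Tile (Label σ)) :
    (borderLabel T).isSome = T.startLabel.isSome := by
  simp [borderLabel]

theorem startLabel_eq_of_borderLabel_eq {T T' : Tile (Label σ)}
    (h : borderLabel T = borderLabel T') : T.startLabel = T'.startLabel := by
  refine Option.map_injective ?_ h
  rintro ⟨c, i⟩ ⟨c', i'⟩ h
  simp only [Prod.mk.injEq] at h
  exact Prod.ext h.1 (Fin.ext h.2)

/-- The tile is crossed by a left border whose label has the first index. -/
def StartsFirst (T : Tile (Label σ)) : Prop := ∃ l : Label σ, T.startLabel = some l ∧ l.2.val = 0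

theorem StartsFirst.borderLabel_eq {T : Tile (Label σ)} (h : StartsFirst T) :
    ∃ c, borderLabel T = some (c, 0) := by
  obtain ⟨l, hl, h0⟩ := h
  exact ⟨l.1, by simp [borderLabel, hl, h0]⟩

open Classical in
/-- The position, in row `d + 1`, of the child with first index of position `m` in row `d`. -/
noncomputable def child (f : ℕ → ℤ → Tile (Label σ)) (d : ℕ) (m : ℤ) : ℤ :=
  2 * m + if StartsFirst (f (d + 1) (2 * m)) then 0 else 1

theorem child_mem (f : ℕ → ℤ → Tile (Label σ)) (d : ℕ) (m : ℤ) :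
    2 * m ≤ child f d m ∧ child f d m ≤ 2 * m + 1 := by
  unfold child; split_ifs <;> omega

theorem child_congr {f g : ℕ → ℤ → Tile (Label σ)} {d : ℕ} {m : ℤ}
    (h : f (d + 1) (2 * m) = g (d + 1) (2 * m)) : child f d m = child g d m := by
  unfold child; rw [h]

/-- The consequences of the local rules for the tiles in the positions `s t^d a^m`. The tile in
row `d` and position `m` lies above the tiles in row `d + 1` and positions `2 m` and `2 m + 1`. -/
structure IsSheet (h H : ℕ) (f : ℕ → ℤ → Tile (Label σ)) : Prop where
  right : ∀ d m, (f d m).rightEdge = (f d (m + 1)).leftEdge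
  botLeft : ∀ d m, (f d m).botLeftEdge = (f (d + 1) (2 * m)).topEdge
  botRight : ∀ d m, (f d m).botRightEdge = (f (d + 1) (2 * m + 1)).topEdge
  kind : ∀ d m, (f d m).kind = (f d 0).kind
  height : ∀ d, ∃ i ≤ h, (f (d + i) 0).kind ≠ Kind.mid
  dense : ∀ d, (f d 0).kind = Kind.top →
    ∀ m : ℤ, ∃ m' : ℤ, m ≤ m' ∧ m' ≤ m + H ∧ (f (d + 1) m').startLabel.isSome
  subst : ∀ d m l, f d m = Tile.b1 l → ∃ n : ℕ, 0 < n ∧ (f d (m + n)).startLabel.isSome ∧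
    (∀ j, m < j → j < m + n → (f d j).startLabel = none) ∧
    (StartsFirst (f (d + 1) (2 * m)) ∨ StartsFirst (f (d + 1) (2 * m + 1))) ∧
    seg (fun j => borderLabel (f (d + 1) j)) (child f d m) (child f d (m + n)) = (σ l.1).zipIdx

/-- Every interval of length `B` contains a left border. -/
def DenseRow (f : ℤ → Tile (Label σ)) (B : ℤ) : Prop :=
  ∀ m, ∃ m', m ≤ m' ∧ m' < m + B ∧ (f m').startLabel.isSome

theorem DenseRow.mono {f : ℤ → Tile (Label σ)} {B B' : ℤ} (h : DenseRow f B) (hB : B ≤ B') :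
    DenseRow f B' := fun m => by
  obtain ⟨m', h1, h2, h3⟩ := h m
  exact ⟨m', h1, by omega, h3⟩

/-! ### Propagation of left borders and labels from a row to the next -/

namespace IsSheet

variable {h H : ℕ} {f g : ℕ → ℤ → Tile (Label σ)}

theorem kind_eq_top_iff (hf : IsSheet h H f) (d : ℕ) :
    (f (d + 1) 0).kind = Kind.top ↔ (f d 0).kind = Kind.bot := by
  rw [← Tile.topEdge_eq_blank_iff, ← Tile.botLeftEdge_eq_blank_iff, hf.botLeft, mul_zero]

theorem startLabel_children (hf : IsSheet h H f) {d : ℕ} (hd : (f d 0).kind ≠ Kind.bot) (m : ℤ) :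
    (f (d + 1) (2 * m)).startLabel.toList ++ (f (d + 1) (2 * m + 1)).startLabel.toList =
      (f d m).startLabel.toList := by
  have hk : ∀ j, (f (d + 1) j).kind ≠ Kind.top := fun j => by
    rw [hf.kind]; exact mt (hf.kind_eq_top_iff d).1 hd
  rw [← Tile.start_bottom (T := f d m) (by rwa [hf.kind]), hf.botLeft, hf.botRight,
    Tile.start_topEdge (hk _), Tile.start_topEdge (hk _)]

theorem borderLabel_children (hf : IsSheet h H f) {d : ℕ} (hd : (f d 0).kind ≠ Kind.bot) (m : ℤ) :
    (borderLabel (f (d + 1) (2 * m))).toList ++ (borderLabel (f (d + 1) (2 * m + 1))).toList =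
      (borderLabel (f d m)).toList := by
  simp only [borderLabel, Option.toList_map, ← List.map_append, hf.startLabel_children hd]

theorem denseRow_succ (hf : IsSheet h H f) {d : ℕ} (hd : (f d 0).kind ≠ Kind.bot) {B : ℤ}
    (hB : DenseRow (f d) B) : DenseRow (f (d + 1)) (2 * B + 2) := by
  intro m
  obtain ⟨u, h1, h2, h3⟩ := hB ((m + 1) / 2)
  have hc := hf.startLabel_children hd u
  by_cases h4 : (f (d + 1) (2 * u)).startLabel.isSome
  · exact ⟨2 * u, by omega, by omega, h4⟩
  · refine ⟨2 * u + 1, by omega, by omega, ?_⟩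
    by_contra h5
    rw [Bool.not_eq_true, Option.isSome_eq_false_iff, Option.isNone_iff_eq_none] at h4 h5
    rw [h4, h5] at hc
    rw [Option.isSome_iff_exists] at h3
    obtain ⟨r, hr⟩ := h3
    simp [hr] at hc

/-- Since a bottom row is followed by a top row, the last row that is not middle above a row that is
not top must be a top row. Just below it gaps are at most `H + 1`, and each further row turns `B`
into `2 B + 2`, a recursion solved by `2 ^ i * (H + 3) - 2`. -/
theorem denseRow_of_above (hf : IsSheet h H f) (i : ℕ) : ∀ d : ℕ, (f (d + i + 1) 0).kind ≠ Kind.top →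
    (∃ j ≤ i, (f (d + j) 0).kind ≠ Kind.mid) → DenseRow (f (d + i + 1)) (2 ^ i * (H + 3) - 2) := by
  induction i with
  | zero =>
    intro d hd ⟨j, hj, hm⟩
    obtain rfl : j = 0 := by omega
    simp only [add_zero] at hm hd ⊢
    have hk : (f d 0).kind = Kind.top := by
      have h1 := mt (hf.kind_eq_top_iff d).2 hd
      cases hk : (f d 0).kind <;> simp_all
    intro m
    obtain ⟨m', h1, h2, h3⟩ := hf.dense d hk m
    exact ⟨m', h1, by simp only [pow_zero]; omega, h3⟩
  | succ i ih =>
    intro d hd ⟨j, hj, hm⟩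
    have hb : (f (d + (i + 1)) 0).kind ≠ Kind.bot := mt (hf.kind_eq_top_iff _).2 hd
    have h2 : (0 : ℤ) < 2 ^ i * (H + 3) := by positivity
    cases hk : (f (d + (i + 1)) 0).kind with
    | bot => exact absurd hk hb
    | top =>
      intro m
      obtain ⟨m', h1, h2', h3⟩ := hf.dense _ hk m
      refine ⟨m', h1, ?_, h3⟩
      have h4 : (1 : ℤ) ≤ 2 ^ i := one_le_pow₀ (by norm_num)
      have h5 : 1 * ((H : ℤ) + 3) ≤ 2 ^ i * (H + 3) := mul_le_mul_of_nonneg_right h4 (by positivity)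
      rw [pow_succ']
      linarith
    | mid =>
      have hji : j ≤ i := by
        by_contra hji
        obtain rfl : j = i + 1 := by omega
        exact hm hk
      have h1 := ih d (by rw [add_assoc, hk]; simp) ⟨j, hji, hm⟩
      have h3 := hf.denseRow_succ (d := d + i + 1) (by rw [add_assoc, hk]; simp) h1
      have e : d + (i + 1) + 1 = d + i + 1 + 1 := by ring
      rw [e]
      refine h3.mono (le_of_eq ?_)
      rw [pow_succ']; ring

/-- The `h + 1` rows above are needed because a row that is not middle is only guaranteed among `h +
1` consecutive ones. -/
theorem denseRow (hf : IsSheet h H f) {d : ℕ} (hd : h + 1 ≤ d) (hk : (f d 0).kind = Kind.bot) :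
    DenseRow (f d) (2 ^ h * (H + 3) - 2) := by
  obtain ⟨e, rfl⟩ := Nat.exists_eq_add_of_le' hd
  exact hf.denseRow_of_above h e (by rw [add_assoc, hk]; simp) (hf.height e)

theorem eq_b1 (hf : IsSheet h H f) {d : ℕ} (hk : (f d 0).kind = Kind.bot) {m : ℤ}
    (hm : (f d m).startLabel.isSome) : ∃ l, f d m = Tile.b1 l := by
  obtain ⟨l, hl⟩ := Option.isSome_iff_exists.1 hm
  exact ⟨l, Tile.eq_b1_of_startLabel (by rw [hf.kind, hk]) hl⟩

/-- Between two left borders of a bottom row, the labels below are given by the substitution. -/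
theorem seg_children (hf : IsSheet h H f) {d : ℕ} (hk : (f d 0).kind = Kind.bot) (n : ℕ) :
    ∀ m : ℤ, (f d m).startLabel.isSome → (f d (m + n)).startLabel.isSome →
    seg (fun j => borderLabel (f (d + 1) j)) (child f d m) (child f d (m + n)) =
      (seg (fun j => borderLabel (f d j)) m (m + n)).flatMap fun p => (σ p.1).zipIdx := by
  induction n using Nat.strong_induction_on with
  | _ n ih =>
    intro m hm hmn
    rcases Nat.eq_zero_or_pos n with rfl | hn
    · simp [seg_self]
    obtain ⟨l, hl⟩ := hf.eq_b1 hk hm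
    obtain ⟨n', hn', h1, h2, -, h4⟩ := hf.subst d m l hl
    -- Otherwise the left border at `m + n` would lie strictly inside the first shaded area.
    have hle : n' ≤ n := by
      by_contra hlt
      rw [h2 (m + n) (by omega) (by omega)] at hmn
      simp at hmn
    obtain ⟨k, rfl⟩ := Nat.exists_eq_add_of_le hle
    have h5 := ih k (by omega) (m + n') h1 (by rwa [add_assoc, ← Nat.cast_add])
    have c0 := child_mem f d m
    have c1 := child_mem f d (m + n')
    have c2 := child_mem f d (m + n' + k)
    have c12 : child f d (m + n') ≤ child f d (m + n' + k) := by
      rcases Nat.eq_zero_or_pos k with rfl | hk0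
      · simp
      · omega
    have h6 : seg (fun j => borderLabel (f d j)) m (m + n') = [(l.1, l.2.val)] := by
      rw [seg_eq_toList (by omega) fun j hj1 hj2 => by simp [borderLabel, h2 j hj1 hj2]]
      simp [hl, borderLabel, Tile.startLabel]
    rw [Nat.cast_add, ← add_assoc, seg_append _ (B := child f d (m + n')) (by omega) c12, h4, h5,
      seg_append (fun j => borderLabel (f d j)) (A := m) (B := m + n') (C := m + n' + k)
      (by omega) (by omega), h6, List.flatMap_append, List.flatMap_singleton]

/-- In a bottom row, left borders lie above the left borders whose labels have the first index. -/
theorem isSome_startLabel_of_startsFirst (hf : IsSheet h H f) {d : ℕ}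
    (hk : (f d 0).kind = Kind.bot) {B : ℤ} (hB : DenseRow (f d) B) {m : ℤ}
    (hm : StartsFirst (f (d + 1) (2 * m)) ∨ StartsFirst (f (d + 1) (2 * m + 1))) :
    (f d m).startLabel.isSome := by
  -- The last left border at or before `m`; density provides one. If `u < m`, then `m` lies strictly
  -- inside the shaded area starting at `u`.
  obtain ⟨u, ⟨hum, hu⟩, hmax⟩ := Int.exists_greatest_of_bdd
    (P := fun u => u ≤ m ∧ (f d u).startLabel.isSome) ⟨m, fun z hz => hz.1⟩ (by
      obtain ⟨u, -, h2, h3⟩ := hB (m + 1 - B)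
      exact ⟨u, by omega, h3⟩)
  rcases hum.eq_or_lt with rfl | hlt
  · exact hu
  exfalso
  obtain ⟨l, hl⟩ := hf.eq_b1 hk hu
  obtain ⟨n, hn, h1, -, h3, h4⟩ := hf.subst d u l hl
  have hmn : m < u + n := by
    by_contra hle
    have := hmax (u + n) ⟨by omega, h1⟩
    omega
  obtain ⟨v, hv1, hv2, hv⟩ : ∃ v, 2 * m ≤ v ∧ v ≤ 2 * m + 1 ∧ StartsFirst (f (d + 1) v) := by
    rcases hm with hm | hm
    · exact ⟨_, le_rfl, by omega, hm⟩
    · exact ⟨_, by omega, le_rfl, hm⟩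
  have hc : StartsFirst (f (d + 1) (child f d u)) := by
    unfold child
    split_ifs with h5
    · simpa using h5
    · exact h3.resolve_left h5
  obtain ⟨b, hb⟩ := hv.borderLabel_eq
  obtain ⟨b', hb'⟩ := hc.borderLabel_eq
  have c0 := child_mem f d u
  have c1 := child_mem f d (u + n)
  have hmem : (b, 0) ∈ seg (fun j => borderLabel (f (d + 1) j)) (child f d u + 1)
      (child f d (u + n)) := mem_seg (j := v) (by omega) (by omega) hb
  rw [seg_append _ (B := child f d u + 1) (by omega) (by omega), seg_succ, hb'] at h4
  -- The indices below one shaded area are distinct, but both `child f d u` and `v` carry the first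
  -- one.
  have h6 : (((σ l.1).zipIdx).map Prod.snd).Nodup := by
    rw [List.zipIdx_map_snd]; exact List.nodup_range'
  rw [← h4, List.map_append] at h6
  simp only [Option.toList_some, List.map_cons, List.map_nil, List.singleton_append,
    List.nodup_cons, List.mem_map] at h6
  exact h6.1 ⟨_, hmem, rfl⟩

end IsSheet

end Sheet

/-! ### Two sheets that agree on the margins -/

section Comparison

variable {A : Type*} [Fintype A] {σ : A → List A} {h H : ℕ} {f g : ℕ → ℤ → Tile (Label σ)}

namespace IsSheet

/-- If two rows of the same type, not a bottom one, lie above rows which agree in the children of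
`m` and in the left child of `m + 1`, then they agree in position `m`. -/
theorem eq_of_children (hf : IsSheet h H f) (hg : IsSheet h H g) {d : ℕ}
    (hk : (f d 0).kind = (g d 0).kind) (hb : (f d 0).kind ≠ Kind.bot) {m : ℤ}
    (h0 : f (d + 1) (2 * m) = g (d + 1) (2 * m))
    (h1 : f (d + 1) (2 * m + 1) = g (d + 1) (2 * m + 1))
    (h2 : f (d + 1) (2 * (m + 1)) = g (d + 1) (2 * (m + 1))) : f d m = g d m := by
  refine Tile.eq_of_bottom (U := f d (m + 1)) (U' := g d (m + 1)) ?_ ?_ ?_ ?_ (hf.right d m)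
    (hg.right d m) ?_ ?_ ?_
  · rw [hf.kind, hg.kind, hk]
  · rwa [hf.kind]
  · rw [hf.botLeft, hg.botLeft, h0]
  · rw [hf.botRight, hg.botRight, h1]
  · rw [hf.kind, hf.kind d m]
  · rw [hg.kind, hg.kind d m]
  · rw [hf.botLeft, hg.botLeft, h2]

/-- A left border of `f` forces a first index on one of its children; these are shared with `g`,
where a first index in turn forces a left border above. -/
theorem isSome_startLabel_of_children (hf : IsSheet h H f) (hg : IsSheet h H g) {d : ℕ}
    (hkf : (f d 0).kind = Kind.bot) (hkg : (g d 0).kind = Kind.bot) {B : ℤ}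
    (hB : DenseRow (g d) B) {m : ℤ} (h0 : f (d + 1) (2 * m) = g (d + 1) (2 * m))
    (h1 : f (d + 1) (2 * m + 1) = g (d + 1) (2 * m + 1)) (hm : (f d m).startLabel.isSome) :
    (g d m).startLabel.isSome := by
  obtain ⟨l, hl⟩ := hf.eq_b1 hkf hm
  obtain ⟨-, -, -, -, h3, -⟩ := hf.subst d m l hl
  rw [h0, h1] at h3
  exact hg.isSome_startLabel_of_startsFirst hkg hB h3

variable {L M W : ℕ → ℤ} {c D : ℕ}

/-- The words of labels of two sheets which agree on the left and right margins are equal in row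
`d + 1` if they are in row `d`. -/
theorem seg_succ_eq (hf : IsSheet h H f) (hg : IsSheet h H g) {d : ℕ} (hd : h + 1 ≤ d)
    (hL : 2 * L d - 1 ≤ L (d + 1) ∧ L (d + 1) ≤ 2 * L d) (hM : M (d + 1) = 2 * M d)
    (hW : W (d + 1) = 2 * W d) (hMW : W d ≤ M d) (hWB : 2 ^ h * (H + 3) < W d)
    (hl : ∀ e, d ≤ e → e ≤ d + 1 → ∀ m, L e ≤ m → m < L e + W e → f e m = g e m)
    (hr : ∀ e, d ≤ e → e ≤ d + 1 → ∀ m, L e + M e ≤ m → m < L e + M e + W e → f e m = g e m)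
    (hQ : seg (fun j => borderLabel (f d j)) (L d) (L d + M d + W d) =
      seg (fun j => borderLabel (g d j)) (L d) (L d + M d + W d)) :
    seg (fun j => borderLabel (f (d + 1) j)) (L (d + 1)) (L (d + 1) + M (d + 1) + W (d + 1)) =
      seg (fun j => borderLabel (g (d + 1) j)) (L (d + 1))
        (L (d + 1) + M (d + 1) + W (d + 1)) := by
  have hpos : (0 : ℤ) < 2 ^ h * (H + 3) := by positivity
  have hD : (f d 0).kind = Kind.bot → DenseRow (f d) (2 ^ h * (H + 3) - 2) := hf.denseRow hd
  generalize (2 : ℤ) ^ h * (H + 3) = B at *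
  have hk : (f d 0).kind = (g d 0).kind := by
    rw [← hf.kind d (L d), ← hg.kind d (L d), hl d le_rfl (by omega) _ le_rfl (by omega)]
  have restrict : ∀ a b, L d ≤ a → a ≤ L d + W d → L d + M d ≤ b → b ≤ L d + M d + W d →
      seg (fun j => borderLabel (f d j)) a b = seg (fun j => borderLabel (g d j)) a b := by
    intro a b h1 h2 h3 h4
    refine (seg_eq_iff_of_margins h1 (by omega) h4 ?_ ?_).1 hQ
    · intro j hj1 hj2
      simp only [hl d le_rfl (by omega) j hj1 (by omega)]
    · intro j hj1 hj2
      simp only [hr d le_rfl (by omega) j (by omega) hj2]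
  have extend : ∀ a b, L (d + 1) ≤ a → a ≤ L (d + 1) + W (d + 1) → L (d + 1) + M (d + 1) ≤ b →
      b ≤ L (d + 1) + M (d + 1) + W (d + 1) →
      seg (fun j => borderLabel (f (d + 1) j)) a b =
        seg (fun j => borderLabel (g (d + 1) j)) a b →
      seg (fun j => borderLabel (f (d + 1) j)) (L (d + 1)) (L (d + 1) + M (d + 1) + W (d + 1)) =
        seg (fun j => borderLabel (g (d + 1) j)) (L (d + 1))
          (L (d + 1) + M (d + 1) + W (d + 1)) := by
    intro a b h1 h2 h3 h4 hab
    refine (seg_eq_iff_of_margins h1 (by omega) h4 ?_ ?_).2 hab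
    · intro j hj1 hj2
      simp only [hl (d + 1) (by omega) le_rfl j hj1 (by omega)]
    · intro j hj1 hj2
      simp only [hr (d + 1) (by omega) le_rfl j (by omega) hj2]
  by_cases hb : (f d 0).kind = Kind.bot
  · obtain ⟨a, ha1, ha2, ha3⟩ := hD hb (L d)
    obtain ⟨b, hb1, hb2, hb3⟩ := hD hb (L d + M d)
    obtain ⟨n, rfl⟩ := Int.le.dest (show a ≤ b by omega)
    have ca := child_mem f d a
    have cb := child_mem f d (a + n)
    have hca : child f d a = child g d a :=
      child_congr (hl (d + 1) (by omega) le_rfl _ (by omega) (by omega))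
    have hcb : child f d (a + n) = child g d (a + n) :=
      child_congr (hr (d + 1) (by omega) le_rfl _ (by omega) (by omega))
    have hga := hl d le_rfl (by omega) a ha1 (by omega)
    have hgb := hr d le_rfl (by omega) (a + n) hb1 (by omega)
    refine extend (child f d a) (child f d (a + n)) (by omega) (by omega) (by omega) (by omega) ?_
    rw [hf.seg_children hb n a ha3 hb3, hca, hcb,
      hg.seg_children (hk ▸ hb) n a (hga ▸ ha3) (hgb ▸ hb3),
      restrict a (a + n) ha1 (by omega) hb1 (by omega)]
  -- The last position is dropped because `L (d + 1)` may be `2 * L d - 1`, and then its right child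
  -- is outside row `d + 1`.
  · refine extend (2 * L d) (2 * (L d + M d + W d - 1)) (by omega) (by omega) (by omega) (by omega)
      ?_
    rw [seg_double (F := fun j => borderLabel (f d j)) (hf.borderLabel_children hb) (by omega),
      seg_double (F := fun j => borderLabel (g d j)) (hg.borderLabel_children (hk ▸ hb)) (by omega)]
    exact restrict _ _ le_rfl (by omega) (by omega) (by omega)

/-- Row `d` of two sheets agrees if their rows `d + 1` agree and if row `d` carries the same word of
labels in both. -/
theorem row_eq_of_succ (hf : IsSheet h H f) (hg : IsSheet h H g) {d : ℕ} (hd : h + 1 ≤ d)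
    (hL : 2 * L d - 1 ≤ L (d + 1) ∧ L (d + 1) ≤ 2 * L d) (hM : M (d + 1) = 2 * M d)
    (hW : W (d + 1) = 2 * W d) (hW0 : 0 < W d)
    (hl : ∀ m, L d ≤ m → m < L d + W d → f d m = g d m)
    (hr : ∀ m, L d + M d ≤ m → m < L d + M d + W d → f d m = g d m)
    (hQ : seg (fun j => borderLabel (f d j)) (L d) (L d + M d + W d) =
      seg (fun j => borderLabel (g d j)) (L d) (L d + M d + W d))
    (hs : ∀ m, L (d + 1) ≤ m → m < L (d + 1) + M (d + 1) + W (d + 1) →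
      f (d + 1) m = g (d + 1) m) :
    ∀ m, L d ≤ m → m < L d + M d + W d → f d m = g d m := by
  have hk : (f d 0).kind = (g d 0).kind := by
    rw [← hf.kind d (L d), ← hg.kind d (L d), hl _ le_rfl (by omega)]
  by_cases hb : (f d 0).kind = Kind.bot
  · have hbg : (g d 0).kind = Kind.bot := hk ▸ hb
    have hS : ∀ m, L d ≤ m → m < L d + M d + W d →
        (f d m).startLabel.isSome = (g d m).startLabel.isSome := by
      intro m h1 h2
      by_cases h3 : L d + M d ≤ m
      · rw [hr m h3 h2]
      have e0 := hs (2 * m) (by omega) (by omega)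
      have e1 := hs (2 * m + 1) (by omega) (by omega)
      rw [Bool.eq_iff_iff]
      exact ⟨hf.isSome_startLabel_of_children hg hb hbg (hg.denseRow hd hbg) e0 e1,
        hg.isSome_startLabel_of_children hf hbg hb (hf.denseRow hd hb) e0.symm e1.symm⟩
    have hlab : ∀ m, L d ≤ m → m < L d + M d + W d → (f d m).startLabel = (g d m).startLabel :=
      fun m h1 h2 => startLabel_eq_of_borderLabel_eq (eq_of_seg_eq (fun j hj1 hj2 => by
        rw [isSome_borderLabel, isSome_borderLabel, hS j hj1 hj2]) hQ m h1 h2)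
    -- From left to right: the previous tile supplies the left edge, and the right margin, known
    -- beforehand, keeps the right neighbour inside the row.
    have key : ∀ n : ℕ, L d + n < L d + M d + W d → f d (L d + n) = g d (L d + n) := by
      intro n
      induction n with
      | zero => intro _; exact hl _ (by omega) (by omega)
      | succ n ih =>
        intro hn
        by_cases h3 : L d + M d ≤ L d + (n + 1 : ℕ)
        · exact hr _ h3 hn
        have h4 := ih (by omega)
        push_cast at hn h3 ⊢
        refine Tile.eq_of_left (U := f d (L d + (n + 1) + 1)) (U' := g d (L d + (n + 1) + 1))
          ?_ ?_ ?_ (hlab _ (by omega) hn) (hf.right d _) (hg.right d _) ?_ ?_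
          (hS _ (by omega) (by omega))
        · rw [hf.kind, hb]
        · rw [hg.kind, hbg]
        · rw [← add_assoc, ← hf.right, ← hg.right, h4]
        · rw [hf.kind, hb]
        · rw [hg.kind, hbg]
    intro m h1 h2
    obtain ⟨n, rfl⟩ := Int.le.dest h1
    exact key n h2
  · intro m h1 h2
    by_cases h3 : L d + M d ≤ m
    · exact hr m h3 h2
    exact hf.eq_of_children hg hk hb (hs _ (by omega) (by omega)) (hs _ (by omega) (by omega))
      (hs _ (by omega) (by omega))

/-- Two sheets which agree in rows `c` and `D` and on the left and right margins agree in all rows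
between `c` and `D`. -/
theorem eq_of_margins (hf : IsSheet h H f) (hg : IsSheet h H g) (hc : h + 1 ≤ c)
    (hL : ∀ d, c ≤ d → d < D → 2 * L d - 1 ≤ L (d + 1) ∧ L (d + 1) ≤ 2 * L d)
    (hM : ∀ d, c ≤ d → M (d + 1) = 2 * M d) (hW : ∀ d, c ≤ d → W (d + 1) = 2 * W d)
    (hMW : ∀ d, c ≤ d → W d ≤ M d) (hWB : ∀ d, c ≤ d → 2 ^ h * (H + 3) < W d)
    (hl : ∀ d, c ≤ d → d ≤ D → ∀ m, L d ≤ m → m < L d + W d → f d m = g d m)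
    (hr : ∀ d, c ≤ d → d ≤ D → ∀ m, L d + M d ≤ m → m < L d + M d + W d → f d m = g d m)
    (hfirst : ∀ m, L c ≤ m → m < L c + M c + W c → f c m = g c m)
    (hlast : ∀ m, L D ≤ m → m < L D + M D + W D → f D m = g D m) {d : ℕ} (hcd : c ≤ d)
    (hdD : d ≤ D) {m : ℤ} (h1 : L d ≤ m) (h2 : m < L d + M d + W d) : f d m = g d m := by
  have hpos : (0 : ℤ) < 2 ^ h * (H + 3) := by positivity
  -- The downward pass, on words of labels, starting from row `c`.
  have hQ : ∀ e, c ≤ e → e ≤ D → seg (fun j => borderLabel (f e j)) (L e) (L e + M e + W e) =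
      seg (fun j => borderLabel (g e j)) (L e) (L e + M e + W e) := by
    intro e he
    induction e, he using Nat.le_induction with
    | base => exact fun _ => seg_congr fun j hj1 hj2 => by rw [hfirst j hj1 hj2]
    | succ e he ih =>
      intro heD
      exact hf.seg_succ_eq hg (hc.trans he) (hL e he heD) (hM e he) (hW e he) (hMW e he) (hWB e he)
        (fun e' h1 h2 => hl e' (he.trans h1) (h2.trans heD))
        (fun e' h1 h2 => hr e' (he.trans h1) (h2.trans heD)) (ih (by omega))
  -- The upward pass, on tiles, starting from row `D`.
  have hrow : ∀ e, e ≤ D → c ≤ e → ∀ m, L e ≤ m → m < L e + M e + W e → f e m = g e m := by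
    intro e he
    induction he using Nat.decreasingInduction with
    | self => exact fun _ => hlast
    | of_succ e he ih =>
      intro hce
      exact hf.row_eq_of_succ hg (hc.trans hce) (hL e hce he) (hM e hce) (hW e hce)
        (hpos.trans (hWB e hce)) (hl e hce he.le) (hr e hce he.le) (hQ e hce he.le)
        (ih (by omega))
  exact hrow d hdD hcd m h1 h2

end IsSheet

end Comparison

/-! ### From configurations and rectangles to sheets -/

section Configuration

variable {A : Type*} [Fintype A] {σ : A → List A}

/-- The sheet of a configuration through `s`. -/
def sheet (x : BS12 → Tile (Label σ)) (s : BS12) : ℕ → ℤ → Tile (Label σ) :=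
  fun d m => x (s * t ^ d * a ^ m)

theorem sheet_pos_mul_t (s : BS12) (d : ℕ) (m : ℤ) :
    s * t ^ d * a ^ m * t = s * t ^ (d + 1) * a ^ (2 * m) := by
  rw [mul_assoc, zpow_a_mul_t, ← mul_assoc, mul_assoc s, pow_succ]

theorem isSheet_sheet {h H : ℕ} {lo hi : A → ℕ} (hH : ∀ c, hi c ≤ H) {x : BS12 → Tile (Label σ)}
    (hx : x ∈ tilingSFT σ h lo hi) (s : BS12) : IsSheet h H (sheet x s) := by
  have ea : ∀ (d : ℕ) (m : ℤ), s * t ^ d * a ^ m * a = s * t ^ d * a ^ (m + 1) :=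
    fun d m => by rw [zpow_add_one, mul_assoc _ (a ^ m) a]
  have en : ∀ (d : ℕ) (m : ℤ) (n : ℕ), s * t ^ d * a ^ m * a ^ n = s * t ^ d * a ^ (m + n) :=
    fun d m n => by rw [zpow_add, zpow_natCast, mul_assoc _ (a ^ m)]
  have ei : ∀ (d : ℕ) (m : ℤ) (n : ℕ), s * t ^ d * a ^ m * (a ^ n)⁻¹ = s * t ^ d * a ^ (m - n) :=
    fun d m n => by rw [zpow_sub, zpow_natCast, mul_assoc _ (a ^ m)]
  have e0 : ∀ d : ℕ, s * t ^ d = s * t ^ d * a ^ (0 : ℤ) := fun d => by simp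
  have hwidth : ∀ (d : ℕ) (m : ℤ) (n : ℕ), HasWidth x (s * t ^ d * a ^ m) n →
      0 < n ∧ (sheet x s d (m + n)).startLabel.isSome ∧
        ∀ j, m < j → j < m + n → (sheet x s d j).startLabel = none := by
    rintro d m n ⟨h0, -, h2, h3⟩
    rw [en] at h2
    refine ⟨h0, h2, fun j hj1 hj2 => ?_⟩
    obtain ⟨i, rfl⟩ := Int.le.dest hj1.le
    have := h3 i (by omega) (by omega)
    rwa [en] at this
  have hkind : ∀ (d : ℕ) (m : ℤ), (sheet x s d m).kind = (sheet x s d 0).kind := by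
    intro d m
    have h1 : ∀ m, (sheet x s d m).kind = (sheet x s d (m + 1)).kind := fun m => by
      have := (hx (s * t ^ d * a ^ m)).2.1
      rwa [RowKind, ea] at this
    induction m using Int.induction_on with
    | zero => rfl
    | succ i ih => rw [← h1, ih]
    | pred i ih => rw [h1, sub_add_cancel, ih]
  refine ⟨fun d m => ?_, fun d m => ?_, fun d m => ?_, hkind, fun d => ?_, fun d hd m => ?_,
    fun d m l hl => ?_⟩
  · have := (hx (s * t ^ d * a ^ m)).1.1
    rwa [ea] at this
  · have := (hx (s * t ^ d * a ^ m)).1.2.1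
    rwa [sheet_pos_mul_t] at this
  · have := (hx (s * t ^ d * a ^ m)).1.2.2
    rwa [sheet_pos_mul_t, ea] at this
  · obtain ⟨i, hi, hne⟩ := (hx (s * t ^ d)).2.2.1.2
    refine ⟨i, hi, ?_⟩
    rwa [mul_assoc, ← pow_add, e0] at hne
  · obtain ⟨u, hu⟩ : ∃ u, m = 2 * u ∨ m = 2 * u + 1 := ⟨m / 2, by omega⟩
    have hk : (x (s * t ^ d * a ^ u)).kind = Kind.top := (hkind d u).trans hd
    obtain ⟨q, n, l, hq, -, -, hn, hw⟩ := (hx (s * t ^ d * a ^ u)).2.2.2.1 hk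
      (s * t ^ (d + 1) * a ^ m) (by
        rw [sheet_pos_mul_t, ea]; rcases hu with rfl | rfl <;> simp)
    rw [ei] at hw
    have := hn.trans (hH l.1)
    -- The shaded area containing `m` starts at `m - q`, and the next left border is at its right
    -- end.
    exact ⟨m - q + n, by omega, by omega, (hwidth _ _ _ hw).2.1⟩
  · obtain ⟨hF, n, -, hw, hlab⟩ := (hx (s * t ^ d * a ^ m)).2.2.2.2.2 l hl
    obtain ⟨h0, h1, h2⟩ := hwidth _ _ _ hw
    have hfc : ∀ j, child (sheet x s) d j = 2 * j + firstChild x (s * t ^ d * a ^ j) := by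
      intro j
      by_cases hj : IsFirst x (s * t ^ d * a ^ j * t)
      · rw [firstChild, if_pos hj, child, if_pos]
        · rfl
        · rwa [sheet_pos_mul_t] at hj
      · rw [firstChild, if_neg hj, child, if_neg]
        · rfl
        · rwa [sheet_pos_mul_t] at hj
    refine ⟨n, h0, h1, h2, ?_, ?_⟩
    · rwa [sheet_pos_mul_t, ea] at hF
    · have c0 := firstChild_le_one x (s * t ^ d * a ^ m)
      rw [← hlab, en, hfc, hfc, startLabels, seg, List.range'_eq_map_range, List.filterMap_map]
      rw [show (2 * (m + n) + (firstChild x (s * t ^ d * a ^ (m + n)) : ℤ) -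
        (2 * m + firstChild x (s * t ^ d * a ^ m))).toNat =
        2 * n + firstChild x (s * t ^ d * a ^ (m + n)) - firstChild x (s * t ^ d * a ^ m) by omega]
      refine List.filterMap_congr fun q _ => ?_
      simp only [Function.comp, sheet_pos_mul_t, en, borderLabel, sheet]
      push_cast
      rw [add_assoc]

/-- From row `c = h + H + 6` on, the margins have width at least `2 ^ (h + H + 5)`, more than the
gap bound `2 ^ h * (H + 3)`, and `h + 1` rows lie above. -/
theorem determinedByBoundary_tilingSFT {h H : ℕ} {lo hi : A → ℕ} (hH : ∀ c, hi c ≤ H) (k l : ℕ) :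
    DeterminedByBoundary (tilingSFT σ h lo hi) (h + H + 6) k l := by
  classical
  rintro p ⟨x, hx, g, hp⟩ q ⟨y, hy, g', hq⟩ hpq
  have known : ∀ i j, i < (k + 1) * 2 ^ l / 2 → j ≤ l →
      (j ≤ h + H + 6 ∨ l ≤ j + (h + H + 6) ∨ 2 * i < 2 ^ l ∨ k * 2 ^ l ≤ 2 * i) →
      x (g * (t ^ l * a ^ i * (t ^ j)⁻¹)) = y (g' * (t ^ l * a ^ i * (t ^ j)⁻¹)) := by
    intro i j hi hj hb
    have h1 : t ^ l * a ^ i * (t ^ j)⁻¹ ∈ rectBoundary (h + H + 6) k l :=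
      Finset.mem_image.2 ⟨(i, j), by simp [hi, hb]; omega, rfl⟩
    have h2 := rectBoundary_subset_rect _ _ _ h1
    have h3 := hpq ⟨_, h2⟩ h1
    rwa [← hp, ← hq] at h3
  funext ⟨u, hu⟩
  rw [← hp, ← hq]
  obtain ⟨⟨i, j⟩, hij, rfl⟩ := Finset.mem_image.1 hu
  simp only [Finset.mem_product, Finset.mem_range] at hij
  obtain ⟨hi, hj⟩ := hij
  simp only
  by_cases hb : j ≤ h + H + 6 ∨ l ≤ j + (h + H + 6) ∨ 2 * i < 2 ^ l ∨ k * 2 ^ l ≤ 2 * i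
  · exact known i j hi (by omega) hb
  push Not at hb
  obtain ⟨hb1, hb2, -, hb4⟩ := hb
  -- For `k = 0` the whole rectangle is boundary.
  have hk : 1 ≤ k := by
    by_contra hk
    obtain rfl : k = 0 := by omega
    simp at hb4
  have hpow : ∀ d, 1 ≤ d → d ≤ l → (2 : ℕ) ^ l = 2 * (2 ^ (d - 1) * 2 ^ (l - d)) := by
    intro d h1 h2
    rw [← pow_add, ← pow_succ']
    congr 1; omega
  have hwid : ∀ d, 1 ≤ d → d ≤ l → (k + 1) * 2 ^ l / 2 = (k + 1) * (2 ^ (d - 1) * 2 ^ (l - d)) := by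
    intro d h1 h2
    rw [hpow d h1 h2, mul_left_comm, Nat.mul_div_cancel_left _ two_pos]
  -- the tiles of the sheet through `u`, in the coordinates of the rectangle
  have pos : ∀ (d : ℕ) (m : ℤ), d ≤ l → t ^ l * a ^ i * (t ^ l)⁻¹ * t ^ d * a ^ m =
      t ^ l * a ^ ((i : ℤ) + 2 ^ (l - d) * m) * (t ^ (l - d))⁻¹ := by
    intro d m hd
    have e1 : (t ^ l)⁻¹ * t ^ d = (t ^ (l - d))⁻¹ := by
      rw [inv_mul_eq_iff_eq_mul, eq_mul_inv_iff_mul_eq, ← pow_add, Nat.add_sub_cancel' hd]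
    have e2 : (t ^ (l - d))⁻¹ * a ^ m = a ^ (2 ^ (l - d) * m) * (t ^ (l - d))⁻¹ := by
      rw [inv_mul_eq_iff_eq_mul, ← mul_assoc, ← zpow_a_mul_t_pow, mul_inv_cancel_right]
    rw [mul_assoc (t ^ l * a ^ i), e1, mul_assoc (t ^ l * a ^ i), e2, zpow_add, zpow_natCast]
    simp only [mul_assoc]
  set f := sheet x (g * (t ^ l * a ^ i * (t ^ l)⁻¹)) with hf
  set f' := sheet y (g' * (t ^ l * a ^ i * (t ^ l)⁻¹)) with hf'
  -- Row `d` of the sheet is level `j = l - d`, and its position `m` has first coordinate `i + 2 ^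
  -- (l - d) * m`. So `L d` is the leftmost position in the rectangle, `W d` the width of a margin,
  -- and `L d + M d` the start of the right margin.
  let L : ℕ → ℤ := fun d => -((i / 2 ^ (l - d) : ℕ) : ℤ)
  let W : ℕ → ℤ := fun d => ((2 ^ (d - 1) : ℕ) : ℤ)
  let M : ℕ → ℤ := fun d => ((k * 2 ^ (d - 1) : ℕ) : ℤ)
  have agree : ∀ d, 1 ≤ d → d ≤ l → ∀ m, L d ≤ m → m < L d + M d + W d →
      (d ≤ h + H + 6 ∨ l ≤ d + (h + H + 6) ∨ m < L d + W d ∨ L d + M d ≤ m) →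
      f d m = f' d m := by
    intro d hd1 hdl m h1 h2 h3
    simp only [L, M, W] at h1 h2 h3
    obtain ⟨n, rfl⟩ := Int.le.dest h1
    have hi' := Nat.div_add_mod i (2 ^ (l - d))
    have hmod := Nat.mod_lt i (show 0 < 2 ^ (l - d) by positivity)
    generalize hE : 2 ^ (l - d) = E at *
    -- The sheet meets level `l - d` in the residue class of `i` modulo `2 ^ (l - d)`.
    have e : (i : ℤ) + E * (-((i / E : ℕ) : ℤ) + n) = ((i % E + E * n : ℕ) : ℤ) := by
      have h4 : (i : ℤ) = E * ((i / E : ℕ) : ℤ) + ((i % E : ℕ) : ℤ) := by exact_mod_cast hi'.symm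
      rw [Nat.cast_add, Nat.cast_mul]
      linear_combination h4
    have key := pos d (-((i / E : ℕ) : ℤ) + n) hdl
    rw [show (2 : ℤ) ^ (l - d) = (E : ℤ) by rw [← hE]; push_cast; rfl, e, zpow_natCast] at key
    have hgu : ∀ b : BS12, b * (t ^ l * a ^ i * (t ^ l)⁻¹) * t ^ d *
        a ^ (-((i / E : ℕ) : ℤ) + n) = b * (t ^ l * a ^ (i % E + E * n) * (t ^ (l - d))⁻¹) := by
      intro b
      rw [← key]
      simp only [mul_assoc]
    simp only [hf, hf', sheet, hgu]
    have hp2 := hpow d hd1 hdl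
    have hw2 := hwid d hd1 hdl
    rw [hE] at hp2 hw2
    generalize 2 ^ (d - 1) = P at *
    apply known
    · rw [hw2]
      have h4 : n + 1 ≤ (k + 1) * P := by
        rw [add_mul, one_mul]; omega
      calc i % E + E * n < E * (n + 1) := by rw [mul_add, mul_one]; omega
        _ ≤ E * ((k + 1) * P) := Nat.mul_le_mul_left _ h4
        _ = (k + 1) * (P * E) := by ring
    · omega
    · rcases h3 with h3 | h3 | h3 | h3
      · exact Or.inr (Or.inl (by omega))
      · exact Or.inl (by omega)
      · refine Or.inr (Or.inr (Or.inl ?_))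
        rw [hp2]
        have h4 : n + 1 ≤ P := by omega
        have h5 := Nat.mul_le_mul_left E h4
        rw [mul_add, mul_one, mul_comm E P] at h5
        omega
      · refine Or.inr (Or.inr (Or.inr ?_))
        rw [hp2]
        have h4 : k * P ≤ n := by omega
        have h5 := Nat.mul_le_mul_left E h4
        calc k * (2 * (P * E)) = 2 * (E * (k * P)) := by ring
          _ ≤ 2 * (i % E + E * n) := by omega
  have hfirst : l - (l - j) = j := by omega
  have hval : ∀ b : BS12, b * (t ^ l * a ^ i * (t ^ l)⁻¹) * t ^ (l - j) * a ^ (0 : ℤ) =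
      b * (t ^ l * a ^ i * (t ^ j)⁻¹) := by
    intro b
    have h1 := pos (l - j) 0 (by omega)
    rw [hfirst, mul_zero, add_zero, zpow_natCast] at h1
    rw [← h1]
    simp only [mul_assoc]
  have hdouble : ∀ d, 1 ≤ d → 2 ^ (d + 1 - 1) = 2 * 2 ^ (d - 1) := by
    intro d hd
    rw [← pow_succ']; congr 1; omega
  have main : f (l - j) 0 = f' (l - j) 0 := by
    refine IsSheet.eq_of_margins (isSheet_sheet hH hx _) (isSheet_sheet hH hy _)
      (L := L) (M := M) (W := W) (c := h + H + 6) (D := l) (by omega) ?_ ?_ ?_ ?_ ?_ ?_ ?_ ?_ ?_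
      (by omega) (by omega) ?_ ?_
    · intro d _ hd
      have h1 : i / 2 ^ (l - d) = i / 2 ^ (l - (d + 1)) / 2 := by
        rw [Nat.div_div_eq_div_mul, ← pow_succ]; congr 2; omega
      simp only [L, h1]
      omega
    · intro d hd
      simp only [M, hdouble d (by omega)]
      push_cast; ring
    · intro d hd
      simp only [W, hdouble d (by omega)]
      push_cast; ring
    · intro d _
      simp only [M, W, Nat.cast_le]
      exact Nat.le_mul_of_pos_left _ hk
    · intro d hd
      have h1 : H + 3 < 2 ^ (H + 5) := by
        have := Nat.lt_two_pow_self (n := H + 5)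
        omega
      have h2 : 2 ^ h * (H + 3) < 2 ^ (d - 1) :=
        calc 2 ^ h * (H + 3) < 2 ^ h * 2 ^ (H + 5) := Nat.mul_lt_mul_of_pos_left h1 (by positivity)
          _ = 2 ^ (h + H + 5) := by rw [← pow_add, add_assoc]
          _ ≤ 2 ^ (d - 1) := Nat.pow_le_pow_right two_pos (by omega)
      simp only [W]
      exact_mod_cast h2
    · intro d hd hdl m h1 h2
      exact agree d (by omega) hdl m h1 (by simp only [M, W] at h2 ⊢; omega)
        (Or.inr (Or.inr (Or.inl h2)))
    · intro d hd hdl m h1 h2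
      exact agree d (by omega) hdl m (by simp only [M] at h1 ⊢; omega) h2
        (Or.inr (Or.inr (Or.inr h1)))
    · exact fun m h1 h2 => agree _ (by omega) (by omega) m h1 h2 (Or.inl le_rfl)
    · exact fun m h1 h2 => agree _ (by omega) le_rfl m h1 h2 (Or.inr (Or.inl (by omega)))
    · exact neg_nonpos.2 (Nat.cast_nonneg _)
    · have h1 := hwid (l - j) (by omega) (by omega)
      rw [hfirst] at h1
      have h2 : i / 2 ^ j < (k + 1) * 2 ^ (l - j - 1) := by
        refine Nat.div_lt_of_lt_mul ?_
        rw [h1] at hi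
        calc i < _ := hi
          _ = _ := by ring
      rw [add_mul, one_mul] at h2
      simp only [L, M, W, hfirst]
      omega
  simpa only [hf, hf', sheet, hval] using main

theorem tilingSFT_properties (σ : A → List A) (h : ℕ) (lo hi : A → ℕ) :
    IsSFT (tilingSFT σ h lo hi) ∧ HasEntropy (tilingSFT σ h lo hi) 0 ∧
      ∃ c : ℕ, ∀ k l : ℕ, DeterminedByBoundary (tilingSFT σ h lo hi) c k l := by
  have : Finite (Tile (Label σ)) := finite_tile
  have hdet : ∀ k l, DeterminedByBoundary (tilingSFT σ h lo hi) _ k l :=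
    determinedByBoundary_tilingSFT fun c => Finset.le_sup (Finset.mem_univ c)
  exact ⟨isSFT_tilingSFT h lo hi, hasEntropy_zero_of_determined hdet, _, hdet⟩

end Configuration

end BSTiling

theorem mainTheorem5 {A : Type*} [Fintype A] [DecidableEq A] (hA : 2 ≤ Fintype.card A)
    (σ : A → List A) (hσ : BSTiling.IsPrimitive σ) (lam : ℝ) (v : A → ℝ)
    (hv_eig : ((BSTiling.incidence σ).map (fun n : ℕ => (n : ℝ))).mulVec v = lam • v)
    (hlam : 8 ≤ lam) (hv : ∀ c, 3 ≤ v c) :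
    (∀ c : ℕ, Filter.Tendsto
      (fun q : ℕ × ℕ => ((BSTiling.rectBoundary c q.1 q.2).card : ℝ) /
        ((BSTiling.rect q.1 q.2).card : ℝ)) (Filter.atTop ×ˢ Filter.atTop) (nhds 0)) ∧
    (BSTiling.IsSFT (BSTiling.XSigma σ lam v) ∧
      BSTiling.HasEntropy (BSTiling.XSigma σ lam v) 0 ∧
      ∃ c : ℕ, ∀ k l : ℕ, BSTiling.DeterminedByBoundary (BSTiling.XSigma σ lam v) c k l) ∧
    (∀ lo hi : A → ℕ,
      BSTiling.IsSFT (BSTiling.tilingSFT σ (BSTiling.heightParam lam) lo hi) ∧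
      BSTiling.HasEntropy (BSTiling.tilingSFT σ (BSTiling.heightParam lam) lo hi) 0 ∧
      ∃ c : ℕ, ∀ k l : ℕ, BSTiling.DeterminedByBoundary
        (BSTiling.tilingSFT σ (BSTiling.heightParam lam) lo hi) c k l) := by
  exact ⟨BSTiling.tendsto_card_rectBoundary_div, BSTiling.tilingSFT_properties σ _ _ _,
    BSTiling.tilingSFT_properties σ _⟩
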